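/- Let $d\ge 5$ and let $\mu$ be a probability law on $\{0,1,2,\dots\}$ with mean $1$, positive finite variance, and a finite exponential moment, i.e. $\sum_{i\ge 0} e^{\lambda i}\mu(i)<\infty$ for some $\lambda>0$. Put $\mu_{\mathrm{sb}}(i)=i\mu(i)$. Let $\mathcal T$ be the random infinite ordered rooted tree defined as follows. The root has $i$ children with probability $\mu(i-1)$, for every $i\ge 1$; its first child is special and its other children are normal. Every special vertex has a number of children of law $\mu_{\mathrm{sb}}$, one of which, chosen uniformly at random, is special, the others being normal. Every normal vertex has a number of children of law $\mu$, all of them normal. All these choices are independent. The spine consists of the root $\emptyset$ and all special vertices. The past $\mathcal T_-$ of $\mathcal T$ consists of all spine vertices other than the root, together with the normal children of spine vertices that precede the special child of the same parent and all descendants of those normal children. Given $\mathcal T$ and $x\in\mathbb Z^d$, let $(S^x_u)_{u\in\mathcal T}$ be the walk indexed by $\mathcal T$ started from $x$: $S^x_\emptyset=x$, and the increments of $S^x$ along the edges of $\mathcal T$ are independent and uniform on the $2d$ nearest neighbours of the origin in $\mathbb Z^d$. Write $S_u=S^0_u$. Let $$G(x,y)=\mathbb E\Big[\sum_{u\in\mathcal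 T_-}\mathbf 1(S^x_u=y)\Big],\qquad \|G\varphi\|_\infty=\sup_{x\in\mathbb Z^d}\sum_{y\in\mathbb Z^d}G(x,y)\varphi(y)\quad\text{for }\varphi:\mathbb Z^d\to[0,\infty).$$ Then there is a constant $\kappa>0$ (depending only on $d$ and $\mu$) such that, for every $\varphi:\mathbb Z^d\to[0,\infty)$ with $\|G\varphi\|_\infty\le\kappa$, $$\mathbb E\Big[\exp\Big(\sum_{u\in\mathcal T}\varphi(S_u)\Big)\Big]\le 2.$$ -/

import Mathlib

open MeasureTheory ProbabilityTheory
open scoped ENNReal NNReal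

namespace BRW

/-- The lattice `ℤ^d`. -/
abbrev Lattice (d : ℕ) : Type := Fin d → ℤ

/-- A possible vertex of an ordered rooted tree. The root is `[]`, and the children of `u` are
`0 :: u`, `1 :: u`, `2 :: u`, …, in this order; so the parent of `i :: u` is `u`. -/
abbrev Vertex : Type := List ℕ

/-- The uniform law on the `2 d` nearest neighbours `± e_i` of the origin of `ℤ^d`. -/
noncomputable def stepLaw (d : ℕ) [NeZero d] : PMF (Lattice d) :=
  (PMF.uniformOfFintype (Fin d × ℤˣ)).map (fun p => Pi.single p.1 (p.2 : ℤ))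

/-- The size-biased law `μ_sb(i) = i μ(i)` of a law `μ` on `ℕ` with mean one. -/
noncomputable def sizeBiased (μ : PMF ℕ) (hμ : ∑' i : ℕ, (i : ℝ≥0∞) * μ i = 1) : PMF ℕ :=
  ⟨fun i => (i : ℝ≥0∞) * μ i, hμ ▸ ENNReal.summable.hasSum⟩

/-- The uniform law on `{0, …, k - 1}`, for `k ≥ 1`.
The value at `k = 0` is irrelevant: it is only used for `k` distributed as `μ_sb`. -/
noncomputable def uniformBelow : ℕ → PMF ℕ
  | 0 => PMF.pure 0
  | k + 1 => PMF.uniformOfFinset (Finset.range (k + 1)) ⟨0, by simp⟩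

/-- The joint law of `(K, J)`, where `K` has law `μ_sb` and, given `K`, `J` is uniform on
`{0, …, K - 1}`: the number of children of a special vertex, and the index of the special one. -/
noncomputable def spineLaw (μ : PMF ℕ) (hμ : ∑' i : ℕ, (i : ℝ≥0∞) * μ i = 1) : PMF (ℕ × ℕ) :=
  (sizeBiased μ hμ).bind fun k => (uniformBelow k).map fun j => (k, j)

/-- The randomness attached to one vertex `u`. -/
structure Mark (d : ℕ) where
  /-- the number of children of `u`, if `u` is normal
  (for the root: its number of normal children) -/
  normalOffspring : ℕ
  /-- the number of children of `u`, if `u` is special and not the root -/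
  specialOffspring : ℕ
  /-- the index of the special child of `u`, if `u` is special and not the root -/
  specialChild : ℕ
  /-- the increment of the walk along the edge from the parent of `u` to `u` -/
  step : Lattice d

/-- Every set of marks is measurable (there are countably many marks). -/
instance (d : ℕ) : MeasurableSpace (Mark d) := ⊤

/-- The law of one mark: a number of children of law `μ`, a pair (number of children, index of
the special child) of law `spineLaw μ`, and a uniform nearest neighbour step, independent. -/
noncomputable def markLaw (d : ℕ) [NeZero d] (μ : PMF ℕ)
    (hμ : ∑' i : ℕ, (i : ℝ≥0∞) * μ i = 1) : PMF (Mark d) :=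
  μ.bind fun n => (spineLaw μ hμ).bind fun kj => (stepLaw d).map fun s => ⟨n, kj.1, kj.2, s⟩

/-- The sample space: one mark for each possible vertex. -/
abbrev Sample (d : ℕ) : Type := Vertex → Mark d

/-- The probability measure of the model: the marks are independent with law `markLaw d μ`. -/
noncomputable def prob (d : ℕ) [NeZero d] (μ : PMF ℕ)
    (hμ : ∑' i : ℕ, (i : ℝ≥0∞) * μ i = 1) : Measure (Sample d) :=
  Measure.infinitePi fun _ : Vertex => (markLaw d μ hμ).toMeasure

variable {d : ℕ}

/-- The index of the special child of a special vertex; for the root it is the first child. -/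
def specialIndex (ω : Sample d) : Vertex → ℕ
  | [] => 0
  | i :: u => (ω (i :: u)).specialChild

/-- The special vertices, that is, the spine: the root (whose offspring is however produced in
its own way, see `offspring`) and the special child of each special vertex. -/
def IsSpecial (ω : Sample d) : Vertex → Prop
  | [] => True
  | i :: u => IsSpecial ω u ∧ i = specialIndex ω u

open Classical in
/-- The number of children of a vertex: `1` plus a number of law `μ` for the root, a number of
law `μ_sb` for the other special vertices, and a number of law `μ` for normal vertices. -/
noncomputable def offspring (ω : Sample d) : Vertex → ℕ
  | [] => (ω []).normalOffspring + 1
  | i :: u =>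
    if IsSpecial ω (i :: u) then (ω (i :: u)).specialOffspring
    else (ω (i :: u)).normalOffspring

/-- Being a vertex of the infinite tree `𝒯`. -/
def InTree (ω : Sample d) : Vertex → Prop
  | [] => True
  | i :: u => InTree ω u ∧ i < offspring ω u

/-- Lying on the spine, but different from the root, or descending from a normal child of a
spine vertex that comes before its special child. -/
def IsPast (ω : Sample d) : Vertex → Prop
  | [] => False
  | i :: u =>
    IsSpecial ω (i :: u) ∨ (IsSpecial ω u ∧ i < specialIndex ω u) ∨ (¬ IsSpecial ω u ∧ IsPast ω u)

/-- The infinite tree `𝒯`. -/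
def tree (ω : Sample d) : Set Vertex := {u | InTree ω u}

/-- The past `𝒯₋` of `𝒯`: the spine without the root, and everything on the side of the spine
where the root has no child. -/
def past (ω : Sample d) : Set Vertex := {u | InTree ω u ∧ IsPast ω u}

/-- The walk `S^x_u` started from `x`. -/
def walk (ω : Sample d) (x : Lattice d) : Vertex → Lattice d
  | [] => x
  | i :: u => walk ω x u + (ω (i :: u)).step

/-- The Green's function `G(x, y) = 𝔼[∑_{u ∈ 𝒯₋} 𝟙(S^x_u = y)]`. -/
noncomputable def green (d : ℕ) [NeZero d] (μ : PMF ℕ)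
    (hμ : ∑' i : ℕ, (i : ℝ≥0∞) * μ i = 1) (x y : Lattice d) : ℝ≥0∞ :=
  ∫⁻ ω, ∑' u : past ω, (if walk ω x u = y then 1 else 0) ∂(prob d μ hμ)

/-- `‖Gφ‖_∞ = sup_x ∑_y G(x, y) φ(y)`. -/
noncomputable def greenNorm (d : ℕ) [NeZero d] (μ : PMF ℕ)
    (hμ : ∑' i : ℕ, (i : ℝ≥0∞) * μ i = 1) (φ : Lattice d → ℝ≥0) : ℝ≥0∞ :=
  ⨆ x : Lattice d, ∑' y : Lattice d, green d μ hμ x y * (φ y : ℝ≥0∞)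

/-- The total potential `∑_{u ∈ 𝒯} φ(S_u)` collected by the walk started from the origin. -/
noncomputable def totalPotential (φ : Lattice d → ℝ≥0) (ω : Sample d) : ℝ≥0∞ :=
  ∑' u : tree ω, (φ (walk ω 0 u) : ℝ≥0∞)

end BRW

/-!
The proof compares the branching random walk with simple random walk on `ℤ^d`, through the
transition operator `P` (`transition`) and the potential operator `g = ∑ₙ Pⁿ` (`potential`) acting
on nonnegative functions.

*First moments.* The normal subtrees are critical, so the expected contribution of a normal subtree
is given by `P g φ`. Because `μ` has positive variance, a vertex of the spine has, with positive
probability, a normal child in the past. Therefore `‖Gφ‖_∞` controls the supremum of `g g φ`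
(`potential_potential_le`): it suffices to treat functions `φ` for which `ε = sup ggφ` is small.

*Exponential moments.* First-step analysis gives recursive inequalities for the exponential moments
of the sum of `φ` over the first `n` generations of a normal or special subtree. By induction on
`n` these moments are at most `1 + P H` and `1 + P W`, as soon as `H` and `W` satisfy
`e^φ ∑ μ(m) (1 + P H)^m ≤ 1 + H` and `e^φ (∑ k μ(k) (1 + P H)^(k-1)) (1 + P W) ≤ 1 + W`
(`expMoment_normal_le`, `expMoment_special_le`). Letting `n` tend to infinity bounds the
exponential moment of the whole tree by `(1 + H 0) (1 + P W 0)`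
(`lintegral_expENN_treeSum_root_le`), which is at most `2` when `H` and `W` are at most `1 / 4`.

*Supersolutions.* The exponential moment of `μ`, together with its mean being one, gives
`∑ μ(m) (1 + z)^m ≤ 1 + z + C z²` and `∑ k μ(k) (1 + z)^(k-1) ≤ 1 + C z` for small `z`. Then
`H = g (6 φ + 49 C (gφ)²)` and `W = g (8 φ + 14 C gφ)` will do, provided that `H ≤ 7 gφ`
(`exists_supersolutions`), and this follows for small `ε` from the estimate `g ((gφ)²) ≤ C' ε gφ`
(`exists_potential_sq_le`).

*The quadratic estimate.* It is a consequence of the inequality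
`g(x, y) g(y, z) ≤ C g(x, z) (g(x, y) + g(y, z))` for the Green's function `g(x, y)` of simple
random walk (`exists_walkGreen_mul_le`), which holds because `g(x, y)` is comparable to
`(A + |x - y|²)^(-(d - 2) / 2)` (`exists_walkGreen_bounds`). The two-sided comparison needs no
local limit theorem: explicit radial super- and subharmonic functions (`exists_barrier`) and the
maximum principle suffice.
-/

namespace BRW

/-! ### The transition operator and the potential operator of the random walk -/

section Potential

variable {d : ℕ} [NeZero d]

/-- The transition operator of simple random walk on `ℤ^d`, acting on nonnegative functions. -/
noncomputable def transition (f : Lattice d → ℝ≥0∞) (x : Lattice d) : ℝ≥0∞ :=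
  ∑' s, stepLaw d s * f (x + s)

/-- The potential `∑ₙ Pⁿ f` of a nonnegative function `f`, where `P` is the transition operator. -/
noncomputable def potential (f : Lattice d → ℝ≥0∞) (x : Lattice d) : ℝ≥0∞ :=
  ∑' n : ℕ, transition^[n] f x

/-- The Green's function of simple random walk: the expected number of visits to `y` from `x`. -/
noncomputable def walkGreen (x y : Lattice d) : ℝ≥0∞ :=
  potential (Pi.single y 1) x

lemma transition_mono : Monotone (transition (d := d)) := fun _ _ h x =>
  ENNReal.tsum_le_tsum fun s => by gcongr; exact h _

lemma transition_add (f g : Lattice d → ℝ≥0∞) :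
    transition (f + g) = transition f + transition g := by
  ext x
  simp [transition, mul_add, ENNReal.tsum_add]

lemma transition_const_mul (c : ℝ≥0∞) (f : Lattice d → ℝ≥0∞) :
    transition (fun x => c * f x) = fun x => c * transition f x := by
  ext x
  simp only [transition, ← ENNReal.tsum_mul_left]
  exact tsum_congr fun s => by ring

lemma transition_const (c : ℝ≥0∞) :
    transition (fun _ : Lattice d => c) = fun _ => c := by
  ext x
  simp [transition, ENNReal.tsum_mul_right, PMF.tsum_coe]

lemma transition_tsum {ι : Type*} (f : ι → Lattice d → ℝ≥0∞) :
    transition (fun x => ∑' i, f i x) = fun x => ∑' i, transition (f i) x := by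
  ext x
  simp only [transition, ← ENNReal.tsum_mul_left]
  exact ENNReal.tsum_comm

lemma transition_eq_sum (f : Lattice d → ℝ≥0∞) (x : Lattice d) :
    transition f x =
      ∑ p : Fin d × ℤˣ, (2 * d : ℝ≥0∞)⁻¹ * f (x + Pi.single p.1 (p.2 : ℤ)) := by
  classical
  have h : ∀ s, stepLaw d s * f (x + s) =
      ∑ p : Fin d × ℤˣ, if s = Pi.single p.1 (p.2 : ℤ) then
        (2 * d : ℝ≥0∞)⁻¹ * f (x + Pi.single p.1 (p.2 : ℤ)) else 0 := by
    intro s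
    rw [stepLaw, PMF.map_apply, tsum_fintype, Finset.sum_mul]
    refine Finset.sum_congr rfl fun p _ => ?_
    split_ifs with hs
    · subst hs
      simp [mul_comm]
    · simp
  simp only [transition, h]
  rw [Summable.tsum_finsetSum (fun _ _ => ENNReal.summable)]
  exact Finset.sum_congr rfl fun p _ => tsum_ite_eq _ _

lemma iterate_transition_mono (n : ℕ) : Monotone ((transition (d := d))^[n]) :=
  transition_mono.iterate n

lemma iterate_transition_add (n : ℕ) (f g : Lattice d → ℝ≥0∞) :
    transition^[n] (f + g) = transition^[n] f + transition^[n] g := by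
  induction n generalizing f g with
  | zero => rfl
  | succ n ih => simp only [Function.iterate_succ_apply, transition_add, ih]

lemma iterate_transition_const_mul (n : ℕ) (c : ℝ≥0∞) (f : Lattice d → ℝ≥0∞) :
    transition^[n] (fun x => c * f x) = fun x => c * transition^[n] f x := by
  induction n generalizing f with
  | zero => rfl
  | succ n ih => simp only [Function.iterate_succ_apply, transition_const_mul, ih]

lemma iterate_transition_const (n : ℕ) (c : ℝ≥0∞) :
    transition^[n] (fun _ : Lattice d => c) = fun _ => c := by
  induction n with
  | zero => rfl
  | succ n ih => rw [Function.iterate_succ_apply, transition_const, ih]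

lemma iterate_transition_tsum {ι : Type*} (n : ℕ) (f : ι → Lattice d → ℝ≥0∞) :
    transition^[n] (fun x => ∑' i, f i x) = fun x => ∑' i, transition^[n] (f i) x := by
  induction n generalizing f with
  | zero => rfl
  | succ n ih => simp only [Function.iterate_succ_apply, transition_tsum, ih]

lemma potential_mono : Monotone (potential (d := d)) := fun _ _ h x =>
  ENNReal.tsum_le_tsum fun n => iterate_transition_mono n h x

lemma potential_add (f g : Lattice d → ℝ≥0∞) :
    potential (f + g) = potential f + potential g := by
  ext x
  simp [potential, iterate_transition_add, ENNReal.tsum_add]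

lemma potential_const_mul (c : ℝ≥0∞) (f : Lattice d → ℝ≥0∞) :
    potential (fun x => c * f x) = fun x => c * potential f x := by
  ext x
  simp [potential, iterate_transition_const_mul, ENNReal.tsum_mul_left]

lemma potential_tsum {ι : Type*} (f : ι → Lattice d → ℝ≥0∞) :
    potential (fun x => ∑' i, f i x) = fun x => ∑' i, potential (f i) x := by
  ext x
  simp only [potential, iterate_transition_tsum]
  exact ENNReal.tsum_comm

lemma transition_potential (f : Lattice d → ℝ≥0∞) :
    transition (potential f) = fun x => ∑' n : ℕ, transition^[n + 1] f x := by
  have : potential f = fun x => ∑' n : ℕ, transition^[n] f x := rfl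
  rw [this, transition_tsum]
  simp only [Function.iterate_succ_apply']

lemma potential_eq_add_transition (f : Lattice d → ℝ≥0∞) (x : Lattice d) :
    potential f x = f x + transition (potential f) x := by
  rw [transition_potential]
  exact tsum_eq_zero_add' ENNReal.summable

lemma potential_transition (f : Lattice d → ℝ≥0∞) :
    potential (transition f) = transition (potential f) := by
  rw [transition_potential]
  rfl

lemma transition_potential_le (f : Lattice d → ℝ≥0∞) (x : Lattice d) :
    transition (potential f) x ≤ potential f x := by
  rw [potential_eq_add_transition f x]
  exact le_add_self

lemma le_potential (f : Lattice d → ℝ≥0∞) (x : Lattice d) : f x ≤ potential f x := by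
  rw [potential_eq_add_transition f x]
  exact le_self_add

/-- The potential of `f` is the least supersolution of `F = f + P F`. -/
lemma potential_le_of_supersolution {f F : Lattice d → ℝ≥0∞}
    (h : ∀ x, f x + transition F x ≤ F x) (x : Lattice d) : potential f x ≤ F x := by
  have key : ∀ n : ℕ, ∀ x,
      (∑ k ∈ Finset.range n, transition^[k] f x) + transition^[n] F x ≤ F x := by
    intro n
    induction n with
    | zero => intro x; simp
    | succ n ih =>
      intro x
      refine le_trans ?_ (ih x)
      rw [Finset.sum_range_succ, add_assoc]
      gcongr
      have := iterate_transition_mono n (show f + transition F ≤ F from h) x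
      rwa [iterate_transition_add, Pi.add_apply, ← Function.iterate_succ_apply] at this
  refine ENNReal.tsum_le_of_sum_range_le fun n => le_trans le_self_add (key n x)

/-- A subsolution is dominated by the corresponding potential plus its own iterates; when the
iterates tend to zero this is the maximum principle. -/
lemma le_potential_add_iterate {f F : Lattice d → ℝ≥0∞}
    (h : ∀ x, F x ≤ f x + transition F x) (n : ℕ) (x : Lattice d) :
    F x ≤ potential f x + transition^[n] F x := by
  have key : ∀ n : ℕ, ∀ x,
      F x ≤ (∑ k ∈ Finset.range n, transition^[k] f x) + transition^[n] F x := by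
    intro n
    induction n with
    | zero => intro x; simp
    | succ n ih =>
      intro x
      refine (ih x).trans ?_
      rw [Finset.sum_range_succ, add_assoc]
      gcongr
      have := iterate_transition_mono n (show F ≤ f + transition F from h) x
      rwa [iterate_transition_add, Pi.add_apply, ← Function.iterate_succ_apply] at this
  refine (key n x).trans ?_
  gcongr
  exact ENNReal.sum_le_tsum _

lemma potential_eq_tsum_walkGreen (f : Lattice d → ℝ≥0∞) (x : Lattice d) :
    potential f x = ∑' y, walkGreen x y * f y := by
  classical
  have hf : f = fun x => ∑' y, f y * (Pi.single y 1 : Lattice d → ℝ≥0∞) x := by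
    ext x
    rw [tsum_eq_single x]
    · simp
    · intro y hy
      simp [hy.symm]
  conv_lhs => rw [hf]
  simp only [potential_tsum, potential_const_mul, walkGreen]
  exact tsum_congr fun y => mul_comm _ _

lemma transition_translate (f : Lattice d → ℝ≥0∞) (a : Lattice d) :
    transition (fun x => f (x + a)) = fun x => transition f (x + a) := by
  ext x
  simp only [transition]
  exact tsum_congr fun s => by rw [add_right_comm]

lemma potential_translate (f : Lattice d → ℝ≥0∞) (a : Lattice d) :
    potential (fun x => f (x + a)) = fun x => potential f (x + a) := by
  have : ∀ n : ℕ, ∀ f : Lattice d → ℝ≥0∞,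
      transition^[n] (fun x => f (x + a)) = fun x => transition^[n] f (x + a) := by
    intro n
    induction n with
    | zero => intro f; rfl
    | succ n ih => intro f; rw [Function.iterate_succ_apply, transition_translate, ih]; rfl
  ext x
  simp only [potential, this]

lemma walkGreen_eq (x y : Lattice d) : walkGreen x y = walkGreen (x - y) 0 := by
  classical
  have h : (Pi.single y 1 : Lattice d → ℝ≥0∞) =
      fun x => (Pi.single 0 1 : Lattice d → ℝ≥0∞) (x + -y) := by
    ext x
    simp only [Pi.single_apply]
    congr 1
    rw [← sub_eq_add_neg, sub_eq_zero]
  rw [walkGreen, h, potential_translate, walkGreen]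
  simp only [sub_eq_add_neg]

/-- The value of `f` at a neighbour of `x` is controlled by its average over all neighbours. -/
lemma le_transition_of_neighbour (f : Lattice d → ℝ≥0∞) (x : Lattice d) (p : Fin d × ℤˣ) :
    f (x + Pi.single p.1 (p.2 : ℤ)) ≤ 2 * d * transition f x := by
  have hd : (2 * d : ℝ≥0∞) ≠ 0 := by simp [NeZero.ne d]
  have hd' : (2 * d : ℝ≥0∞) ≠ ∞ := by finiteness
  rw [transition_eq_sum]
  calc f (x + Pi.single p.1 (p.2 : ℤ))
      = 2 * d * ((2 * d : ℝ≥0∞)⁻¹ * f (x + Pi.single p.1 (p.2 : ℤ))) := by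
        rw [← mul_assoc, ENNReal.mul_inv_cancel hd hd', one_mul]
    _ ≤ _ := by
        gcongr
        exact Finset.single_le_sum
          (f := fun p : Fin d × ℤˣ => (2 * d : ℝ≥0∞)⁻¹ * f (x + Pi.single p.1 (p.2 : ℤ)))
          (fun _ _ => zero_le) (Finset.mem_univ p)

end Potential

/-! ### Radial barriers for simple random walk -/

section Barrier

/-- Third-order Taylor expansion of `(1 + t) ^ (-q)` at `0`. -/
lemma exists_one_add_rpow_neg_taylor (q : ℝ) : ∃ C δ : ℝ, 0 < C ∧ 0 < δ ∧ δ ≤ 1 / 2 ∧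
    ∀ t : ℝ, |t| ≤ δ →
      |(1 + t) ^ (-q) - (1 - q * t + q * (q + 1) / 2 * t ^ 2 - q * (q + 1) * (q + 2) / 6 * t ^ 3)|
        ≤ C * t ^ 4 := by
  have h := (Real.one_add_rpow_hasFPowerSeriesAt_zero (a := -q)).isBigO_sub_partialSum_pow 4
  obtain ⟨C, hC, h⟩ := h.exists_pos
  rw [Asymptotics.IsBigOWith, Metric.eventually_nhds_iff] at h
  obtain ⟨ε, hε, h⟩ := h
  refine ⟨C, min (ε / 2) (1 / 2), hC, by positivity, min_le_right _ _, fun t ht => ?_⟩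
  have ht' : dist t 0 < ε := by
    rw [Real.dist_0_eq_abs]
    have := min_le_left (ε / 2) (1 / 2)
    linarith
  have := h ht'
  simp only [zero_add, Real.norm_eq_abs, FormalMultilinearSeries.partialSum,
    Finset.sum_range_succ, Finset.sum_range_zero, binomialSeries_apply] at this
  rw [abs_of_nonneg (by positivity : (0 : ℝ) ≤ |t| ^ 4)] at this
  have ht4 : |t| ^ 4 = t ^ 4 := by
    rw [← abs_pow, abs_of_nonneg (by positivity)]
  rw [ht4] at this
  convert this using 3
  have h2 : (2 : Polynomial ℤ).smeval (-q) = 2 := by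
    have := Polynomial.smeval_natCast (R := ℤ) (x := -q) 2
    simpa using this
  simp [Ring.choose_eq_smul, descPochhammer_succ_right, Polynomial.smeval_mul, h2,
    Polynomial.smeval_sub, Nat.factorial]
  ring

/-- Averaging `s ↦ s ^ (-q)` over the increments `1 + a` and `1 - a`: the odd terms of the
expansion cancel, and the error is of order `s ^ (-2)` as soon as `a ^ 2 ≤ 4 s`. -/
lemma exists_average_rpow_neg (q : ℝ) : ∃ C A₀ : ℝ, 0 < C ∧ 1 ≤ A₀ ∧ ∀ s a : ℝ, A₀ ≤ s →
    a ^ 2 ≤ 4 * s → 0 < s + 1 + a ∧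
      |((s + 1 + a) ^ (-q) + (s + 1 - a) ^ (-q)) / 2 -
        s ^ (-q) * (1 - q / s + q * (q + 1) / 2 * (a ^ 2 / s ^ 2))| ≤ C * (s ^ (-q) / s ^ 2) := by
  obtain ⟨C, δ, hC, hδ, hδ2, hT⟩ := exists_one_add_rpow_neg_taylor q
  refine ⟨|q * (q + 1) / 2| + 13 * |q * (q + 1) * (q + 2) / 6| + 41 * C, max 1 (10 / δ ^ 2),
    by positivity, le_max_left _ _, fun s a hs ha => ?_⟩
  have hs1 : 1 ≤ s := (le_max_left _ _).trans hs
  have hs0 : 0 < s := by linarith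
  have hsδ : 10 ≤ δ ^ 2 * s := by
    have := (le_max_right 1 (10 / δ ^ 2)).trans hs
    rwa [div_le_iff₀' (by positivity)] at this
  have key : ∀ b : ℝ, b ^ 2 = a ^ 2 → |(1 + b) / s| ≤ δ := by
    intro b hb
    refine abs_le_of_sq_le_sq ?_ hδ.le
    rw [div_pow, div_le_iff₀ (by positivity)]
    nlinarith [sq_nonneg (1 - b), mul_le_mul_of_nonneg_right hsδ hs0.le]
  have hpos : ∀ b : ℝ, b ^ 2 = a ^ 2 → 0 < 1 + (1 + b) / s := by
    intro b hb
    have := (abs_le.mp (key b hb)).1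
    linarith
  have heq : ∀ b : ℝ, s + 1 + b = s * (1 + (1 + b) / s) := by
    intro b; field_simp; ring
  have hp := hpos a rfl
  have hm := hpos (-a) (by ring)
  refine ⟨by rw [heq]; positivity, ?_⟩
  have e1 := hT _ (key a rfl)
  have e2 := hT _ (key (-a) (by ring))
  rw [sub_eq_add_neg (s + 1) a, heq a, heq (-a), Real.mul_rpow hs0.le hp.le,
    Real.mul_rpow hs0.le hm.le]
  have hsq : 0 < s ^ (-q) := Real.rpow_pos_of_pos hs0 _
  set X := (1 + (1 + a) / s) ^ (-q)
  set Y := (1 + (1 + -a) / s) ^ (-q)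
  have : (s ^ (-q) * X + s ^ (-q) * Y) / 2 -
      s ^ (-q) * (1 - q / s + q * (q + 1) / 2 * (a ^ 2 / s ^ 2)) =
      s ^ (-q) * ((X + Y) / 2 - (1 - q / s + q * (q + 1) / 2 * (a ^ 2 / s ^ 2))) := by ring
  rw [this, abs_mul, abs_of_pos hsq,
    show ∀ K : ℝ, K * (s ^ (-q) / s ^ 2) = s ^ (-q) * (K / s ^ 2) from fun K => by ring]
  gcongr
  have hident : (X + Y) / 2 - (1 - q / s + q * (q + 1) / 2 * (a ^ 2 / s ^ 2)) =
      ((X - (1 - q * ((1 + a) / s) + q * (q + 1) / 2 * ((1 + a) / s) ^ 2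
        - q * (q + 1) * (q + 2) / 6 * ((1 + a) / s) ^ 3)) +
      (Y - (1 - q * ((1 + -a) / s) + q * (q + 1) / 2 * ((1 + -a) / s) ^ 2
        - q * (q + 1) * (q + 2) / 6 * ((1 + -a) / s) ^ 3))) / 2 +
      (q * (q + 1) / 2 * (1 / s ^ 2) -
        q * (q + 1) * (q + 2) / 6 * ((1 + 3 * a ^ 2) / s ^ 3)) := by
    field_simp
    ring
  rw [hident]
  have b1 : |q * (q + 1) / 2 * (1 / s ^ 2)| = |q * (q + 1) / 2| / s ^ 2 := by
    rw [abs_mul, abs_of_pos (by positivity : 0 < 1 / s ^ 2)]; ring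
  have b2 : |q * (q + 1) * (q + 2) / 6 * ((1 + 3 * a ^ 2) / s ^ 3)| ≤
      13 * |q * (q + 1) * (q + 2) / 6| / s ^ 2 := by
    rw [abs_mul, abs_of_pos (by positivity : 0 < (1 + 3 * a ^ 2) / s ^ 3)]
    have : (1 + 3 * a ^ 2) / s ^ 3 ≤ 13 / s ^ 2 := by
      rw [div_le_div_iff₀ (by positivity) (by positivity)]
      have : 1 + 3 * a ^ 2 ≤ 13 * s := by linarith
      calc (1 + 3 * a ^ 2) * s ^ 2 ≤ 13 * s * s ^ 2 := by gcongr
        _ = 13 * s ^ 3 := by ring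
    calc _ ≤ |q * (q + 1) * (q + 2) / 6| * (13 / s ^ 2) := by gcongr
      _ = _ := by ring
  have b3 : C * ((1 + a) / s) ^ 4 + C * ((1 + -a) / s) ^ 4 ≤ 2 * (41 * C / s ^ 2) := by
    have : ((1 + a) / s) ^ 4 + ((1 + -a) / s) ^ 4 ≤ 82 / s ^ 2 := by
      rw [div_pow, div_pow, ← add_div, div_le_div_iff₀ (by positivity) (by positivity)]
      have h4 : (a ^ 2) ^ 2 ≤ (4 * s) ^ 2 := by gcongr
      have : (1 + a) ^ 4 + (1 + -a) ^ 4 ≤ 82 * s ^ 2 := by nlinarith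
      calc ((1 + a) ^ 4 + (1 + -a) ^ 4) * s ^ 2 ≤ 82 * s ^ 2 * s ^ 2 := by gcongr
        _ = _ := by ring
    calc _ = C * (((1 + a) / s) ^ 4 + ((1 + -a) / s) ^ 4) := by ring
      _ ≤ C * (82 / s ^ 2) := by gcongr
      _ = _ := by ring
  rw [show ∀ u v w : ℝ, (u + v + w) / s ^ 2 = u / s ^ 2 + v / s ^ 2 + w / s ^ 2 from
    fun u v w => by ring]
  rw [abs_le] at *
  have b1' := abs_le.mp b1.le
  constructor <;> linarith [e1.1, e1.2, e2.1, e2.2, b2.1, b2.2, b1'.1, b1'.2]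

variable {d : ℕ}

/-- The squared Euclidean norm of a lattice point. -/
def normSq (x : Lattice d) : ℝ := ∑ i, (x i : ℝ) ^ 2

lemma normSq_nonneg (x : Lattice d) : 0 ≤ normSq x :=
  Finset.sum_nonneg fun _ _ => sq_nonneg _

lemma normSq_add_single (x : Lattice d) (i : Fin d) (e : ℤ) :
    normSq (x + Pi.single i e) = normSq x + 2 * e * x i + e ^ 2 := by
  have : ∀ j, (((x + Pi.single i e : Lattice d) j : ℤ) : ℝ) ^ 2 =
      (x j : ℝ) ^ 2 + if j = i then 2 * (e : ℝ) * x i + (e : ℝ) ^ 2 else 0 := by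
    intro j
    by_cases h : j = i
    · subst h; simp; ring
    · simp [h]
  simp only [normSq, this, Finset.sum_add_distrib, Finset.sum_ite_eq', Finset.mem_univ, if_true]
  ring

lemma sq_coord_le_normSq (x : Lattice d) (i : Fin d) : (x i : ℝ) ^ 2 ≤ normSq x :=
  Finset.single_le_sum (f := fun i => (x i : ℝ) ^ 2) (fun _ _ => sq_nonneg _) (Finset.mem_univ i)

lemma finite_normSq_le (R : ℝ) : {x : Lattice d | normSq x ≤ R}.Finite := by
  refine (Set.finite_Icc (fun _ : Fin d => -⌈R⌉) (fun _ => ⌈R⌉)).subset fun x hx => ?_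
  have h : ∀ i, |x i| ≤ ⌈R⌉ := by
    intro i
    have h1 : |x i| ≤ x i ^ 2 := by
      rw [← sq_abs]
      exact Int.le_self_sq _
    have h2 : ((x i ^ 2 : ℤ) : ℝ) ≤ R := by
      push_cast
      exact (sq_coord_le_normSq x i).trans hx
    have h3 : ((x i ^ 2 : ℤ) : ℝ) ≤ (⌈R⌉ : ℤ) := h2.trans (Int.le_ceil R)
    exact h1.trans (by exact_mod_cast h3)
  exact ⟨fun i => (abs_le.mp (h i)).1, fun i => (abs_le.mp (h i)).2⟩

/-- The radial function `(A + |x|²) ^ (-q)`. -/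
noncomputable def radial (A q : ℝ) (x : Lattice d) : ℝ := (A + normSq x) ^ (-q)

lemma radial_pos {A : ℝ} (hA : 0 < A) (q : ℝ) (x : Lattice d) : 0 < radial A q x :=
  Real.rpow_pos_of_pos (by have := normSq_nonneg x; linarith) _

/-- The average of a real function over the neighbours of a point. -/
noncomputable def average (f : Lattice d → ℝ) (x : Lattice d) : ℝ :=
  ∑ p : Fin d × ℤˣ, (2 * d : ℝ)⁻¹ * f (x + Pi.single p.1 (p.2 : ℤ))

lemma transition_ofReal [NeZero d] (f : Lattice d → ℝ) (hf : ∀ x, 0 ≤ f x) (x : Lattice d) :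
    transition (fun x => ENNReal.ofReal (f x)) x = ENNReal.ofReal (average f x) := by
  rw [transition_eq_sum, average, ENNReal.ofReal_sum_of_nonneg
    (fun p _ => mul_nonneg (by positivity) (hf _))]
  refine Finset.sum_congr rfl fun p _ => ?_
  have : (0 : ℝ) < 2 * d := by have := NeZero.pos d; positivity
  rw [ENNReal.ofReal_mul (by positivity), ENNReal.ofReal_inv_of_pos this]
  congr 2
  rw [ENNReal.ofReal_mul (by norm_num)]
  simp

/-- The action of the walk on a radial power, up to an error of lower order by two powers. -/
lemma exists_average_radial [NeZero d] (q : ℝ) : ∃ C A₀ : ℝ, 0 < C ∧ 1 ≤ A₀ ∧ ∀ A, A₀ ≤ A →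
    ∀ x : Lattice d, |average (radial A q) x - radial A q x *
      (1 - q / (A + normSq x) + 2 * q * (q + 1) / d * (normSq x / (A + normSq x) ^ 2))| ≤
        C * (radial A q x / (A + normSq x) ^ 2) := by
  obtain ⟨C, A₀, hC, hA₀, h⟩ := exists_average_rpow_neg q
  refine ⟨C, A₀, hC, hA₀, fun A hA x => ?_⟩
  have hd : (0 : ℝ) < d := by exact_mod_cast NeZero.pos d
  set s := A + normSq x with hs
  have hsA : A₀ ≤ s := by have := normSq_nonneg x; linarith
  have hs0 : 0 < s := by linarith
  have hi : ∀ i : Fin d, (2 * (x i : ℝ)) ^ 2 ≤ 4 * s := by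
    intro i
    have := sq_coord_le_normSq x i
    nlinarith
  have havg : average (radial A q) x = (d : ℝ)⁻¹ * ∑ i : Fin d,
      ((s + 1 + 2 * x i) ^ (-q) + (s + 1 - 2 * x i) ^ (-q)) / 2 := by
    rw [average, Fintype.sum_prod_type, Finset.mul_sum]
    refine Finset.sum_congr rfl fun i _ => ?_
    rw [UnitsInt.univ, Finset.sum_pair (by decide)]
    simp only [radial, normSq_add_single]
    have e1 : A + (normSq x + 2 * (((1 : ℤˣ) : ℤ) : ℝ) * x i + (((1 : ℤˣ) : ℤ) : ℝ) ^ 2) =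
      s + 1 + 2 * x i := by rw [hs]; push_cast; ring
    have e2 : A + (normSq x + 2 * (((-1 : ℤˣ) : ℤ) : ℝ) * x i + (((-1 : ℤˣ) : ℤ) : ℝ) ^ 2) =
      s + 1 - 2 * x i := by rw [hs]; push_cast; ring
    rw [e1, e2]
    field_simp
  have hmain : radial A q x * (1 - q / s + 2 * q * (q + 1) / d * (normSq x / s ^ 2)) =
      (d : ℝ)⁻¹ * ∑ i : Fin d,
        s ^ (-q) * (1 - q / s + q * (q + 1) / 2 * ((2 * (x i : ℝ)) ^ 2 / s ^ 2)) := by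
    have : ∑ i : Fin d,
        s ^ (-q) * (1 - q / s + q * (q + 1) / 2 * ((2 * (x i : ℝ)) ^ 2 / s ^ 2)) =
        s ^ (-q) * (d * (1 - q / s) + 2 * q * (q + 1) / s ^ 2 * normSq x) := by
      rw [← Finset.mul_sum, Finset.sum_add_distrib, normSq, Finset.mul_sum]
      congr 2
      · simp; ring
      · refine Finset.sum_congr rfl fun i _ => ?_
        ring
    rw [this, radial, ← hs]
    field_simp
  rw [havg, hmain, ← mul_sub, ← Finset.sum_sub_distrib, abs_mul, abs_of_pos (inv_pos.mpr hd),
    inv_mul_le_iff₀ hd]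
  calc _ ≤ ∑ i : Fin d, C * (s ^ (-q) / s ^ 2) :=
        (Finset.abs_sum_le_sum_abs _ _).trans
          (Finset.sum_le_sum fun i _ => (h s (2 * x i) hsA (hi i)).2)
    _ = _ := by simp [radial, ← hs]

end Barrier

/-! ### Two-sided bounds on the Green's function of simple random walk -/

section GreenBounds

variable {d : ℕ} [NeZero d]

/-- For `A` large, `(A + |x|²) ^ (-(d - 2) / 2)` is strictly superharmonic, and adding a multiple
of the next power makes it subharmonic outside a finite set. -/
lemma exists_barrier (hd : 3 ≤ d) : ∃ A M R : ℝ, 1 ≤ A ∧ 0 ≤ M ∧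
    (∀ x : Lattice d, average (radial A (((d : ℝ) - 2) / 2)) x ≤
      radial A (((d : ℝ) - 2) / 2) x - radial A (((d : ℝ) - 2) / 2) x / (A + normSq x) ^ 2) ∧
    ∀ x : Lattice d, R ≤ normSq x →
      radial A (((d : ℝ) - 2) / 2) x + M * radial A (((d : ℝ) - 2) / 2 + 1) x ≤
        average (radial A (((d : ℝ) - 2) / 2)) x +
          M * average (radial A (((d : ℝ) - 2) / 2 + 1)) x := by
  set p : ℝ := ((d : ℝ) - 2) / 2 with hp
  have hd3 : (3 : ℝ) ≤ d := by exact_mod_cast hd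
  have hp0 : 0 < p := by rw [hp]; linarith
  have hdp : (d : ℝ) = 2 * (p + 1) := by rw [hp]; ring
  obtain ⟨C₁, A₁, hC₁, hA₁, h₁⟩ := exists_average_radial (d := d) p
  obtain ⟨C₂, A₂, hC₂, hA₂, h₂⟩ := exists_average_radial (d := d) (p + 1)
  set A := max (max A₁ A₂) ((C₁ + 1) / p) with hA
  have hAA₁ : A₁ ≤ A := (le_max_left _ _).trans (le_max_left _ _)
  have hAA₂ : A₂ ≤ A := (le_max_right _ _).trans (le_max_left _ _)
  have hA1 : 1 ≤ A := hA₁.trans hAA₁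
  have hpA : C₁ + 1 ≤ p * A := by
    have : (C₁ + 1) / p ≤ A := le_max_right _ _
    rwa [div_le_iff₀' hp0] at this
  set D := C₂ + 2 * (p + 1) * (p + 2) / d * A with hD
  have hD0 : 0 ≤ D := by positivity
  -- `M` is chosen so that the gain `M (p + 1) (2 / d) s⁻²` beats the loss `(C₁ + p A) s⁻²`.
  set M := C₁ + p * A + 1 with hM
  have hM0 : 0 ≤ M := by positivity
  have e₁ : ∀ x : Lattice d, 1 - p / (A + normSq x) +
      2 * p * (p + 1) / d * (normSq x / (A + normSq x) ^ 2) = 1 - p * A / (A + normSq x) ^ 2 := by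
    intro x
    have : 0 < A + normSq x := by have := normSq_nonneg x; linarith
    rw [hdp]
    field_simp
    ring
  refine ⟨A, M, M * D, hA1, hM0, fun x => ?_, fun x hx => ?_⟩
  · have hs : 0 < A + normSq x := by have := normSq_nonneg x; linarith
    have h := (abs_le.mp (h₁ A hAA₁ x)).2
    rw [e₁] at h
    have hr := radial_pos (by linarith : 0 < A) p x
    have : radial A p x / (A + normSq x) ^ 2 * (C₁ + 1) ≤
        radial A p x / (A + normSq x) ^ 2 * (p * A) := by gcongr
    have e : radial A p x * (1 - p * A / (A + normSq x) ^ 2) =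
      radial A p x - radial A p x / (A + normSq x) ^ 2 * (p * A) := by ring
    rw [e] at h
    linarith
  · have hs : 0 < A + normSq x := by have := normSq_nonneg x; linarith
    have hr := radial_pos (by linarith : 0 < A) p x
    have h1 := (abs_le.mp (h₁ A hAA₁ x)).1
    rw [e₁] at h1
    have h2 := (abs_le.mp (h₂ A hAA₂ x)).1
    have hrad : radial A (p + 1) x = radial A p x / (A + normSq x) := by
      rw [radial, radial, neg_add, Real.rpow_add hs, Real.rpow_neg_one, div_eq_mul_inv]
    rw [hrad] at h2 ⊢
    set s := A + normSq x with hs'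
    set F := radial A p x
    have e₂ : F / s * (1 - (p + 1) / s + 2 * (p + 1) * (p + 1 + 1) / d * (normSq x / s ^ 2)) =
        F / s + F / s ^ 2 - F / s ^ 3 * (2 * (p + 1) * (p + 2) / d * A) := by
      have : normSq x = s - A := by rw [hs']; ring
      rw [this, hdp]
      field_simp
      ring
    rw [e₂] at h2
    have hMs : M * D / s ≤ 1 := by
      rw [div_le_one hs]
      linarith
    have hfin : M * (average (radial A (p + 1)) x - F / s) ≥
        M * (F / s ^ 2) - F / s ^ 2 * (M * D / s) := by
      have : M * (F / s ^ 2) - F / s ^ 2 * (M * D / s) = M * (F / s ^ 2 - F / s ^ 3 * D) := by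
        field_simp
      rw [this, ge_iff_le]
      refine mul_le_mul_of_nonneg_left ?_ hM0
      have e3 : C₂ * (F / s / s ^ 2) = F / s ^ 3 * C₂ := by field_simp
      rw [hD]
      rw [e3] at h2
      linarith
    have h3 : F / s ^ 2 * (M * D / s) ≤ F / s ^ 2 * 1 := by gcongr
    have e4 : F * (1 - p * A / s ^ 2) = F - F / s ^ 2 * (p * A) := by ring
    rw [e4] at h1
    have e5 : C₁ * (F / s ^ 2) = F / s ^ 2 * C₁ := by ring
    have e6 : M * (F / s ^ 2) = F / s ^ 2 * C₁ + F / s ^ 2 * (p * A) + F / s ^ 2 := by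
      rw [hM]; ring
    linarith

/-- Moving the starting point changes the Green's function by at most a constant factor. The
translations with this property form a submonoid, which contains the unit steps. -/
lemma exists_walkGreen_translate_le (b : Lattice d) :
    ∃ C : ℝ≥0, ∀ x : Lattice d, walkGreen (x + b) 0 ≤ C * walkGreen x 0 := by
  let S : AddSubmonoid (Lattice d) :=
    { carrier := {b | ∃ C : ℝ≥0, ∀ x : Lattice d, walkGreen (x + b) 0 ≤ C * walkGreen x 0}
      zero_mem' := ⟨1, fun x => by simp⟩
      add_mem' := by
        rintro a b ⟨C, hC⟩ ⟨C', hC'⟩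
        refine ⟨C' * C, fun x => ?_⟩
        rw [← add_assoc]
        refine (hC' _).trans ?_
        rw [ENNReal.coe_mul, mul_assoc]
        gcongr
        exact hC x }
  have hsingle : ∀ (i : Fin d) (e : ℤˣ), (Pi.single i (e : ℤ) : Lattice d) ∈ S := by
    intro i e
    refine ⟨2 * d, fun x => ?_⟩
    refine (le_transition_of_neighbour (fun x => walkGreen x 0) x (i, e)).trans ?_
    push_cast
    gcongr
    exact transition_potential_le _ x
  have hint : ∀ (i : Fin d) (k : ℤ), (Pi.single i k : Lattice d) ∈ S := by
    intro i k
    obtain ⟨n, rfl | rfl⟩ := k.eq_nat_or_neg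
    · have := S.nsmul_mem (hsingle i 1) n
      rwa [← Pi.single_smul, nsmul_eq_mul, Units.val_one, mul_one] at this
    · have := S.nsmul_mem (hsingle i (-1)) n
      rwa [← Pi.single_smul, nsmul_eq_mul, Units.val_neg, Units.val_one, mul_neg, mul_one] at this
  have : b ∈ S := by
    rw [← Finset.univ_sum_single b]
    exact S.sum_mem fun i _ => hint i _
  exact this

/-- The Green's function of simple random walk in dimension `d ≥ 3` is comparable to
`F x = (A + |x|²) ^ (-(d - 2) / 2)`. Superharmonicity of `F` gives the upper bound. For the lower
bound, `G = F + M (A + |x|²) ^ (-d / 2) ≥ F` is subharmonic off a finite set `B` and tends to zero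
at infinity, so it is dominated by the potential of a multiple of the indicator function of `B`,
and each `walkGreen x y` with `y ∈ B` is comparable to `walkGreen x 0`. -/
lemma exists_walkGreen_bounds (hd : 3 ≤ d) : ∃ (A : ℝ) (c C : ℝ≥0), 1 ≤ A ∧
    (∀ x : Lattice d, walkGreen x 0 ≤ C * ENNReal.ofReal (radial A (((d : ℝ) - 2) / 2) x)) ∧
    ∀ x : Lattice d, ENNReal.ofReal (radial A (((d : ℝ) - 2) / 2) x) ≤ c * walkGreen x 0 := by
  classical
  obtain ⟨A, M, R, hA, hM, hsup, hsub⟩ := exists_barrier hd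
  have hA0 : 0 < A := by linarith
  set p : ℝ := ((d : ℝ) - 2) / 2 with hp
  have hp0 : 0 < p := by
    have hd3 : (3 : ℝ) ≤ d := by exact_mod_cast hd
    rw [hp]; linarith
  set F : Lattice d → ℝ := radial A p with hF
  have hFpos : ∀ x, 0 < F x := radial_pos hA0 p
  set δ₀ : ℝ := F 0 / A ^ 2 with hδ₀
  have hδ₀pos : 0 < δ₀ := by have := hFpos 0; positivity
  have upper : ∀ x : Lattice d, walkGreen x 0 ≤ (δ₀⁻¹).toNNReal * ENNReal.ofReal (F x) := by
    refine potential_le_of_supersolution fun x => ?_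
    simp only [transition_const_mul]
    rw [transition_ofReal F (fun x => (hFpos x).le)]
    have key : (Pi.single 0 1 : Lattice d → ℝ≥0∞) x ≤
        (δ₀⁻¹).toNNReal * ENNReal.ofReal (F x / (A + normSq x) ^ 2) := by
      by_cases hx : x = 0
      · subst hx
        have : normSq (0 : Lattice d) = 0 := by simp [normSq]
        rw [Pi.single_eq_same, this, add_zero, ← hδ₀, ← ENNReal.ofReal,
          ← ENNReal.ofReal_mul (by positivity), inv_mul_cancel₀ hδ₀pos.ne', ENNReal.ofReal_one]
      · simp [hx]
    calc _ ≤ (δ₀⁻¹).toNNReal * ENNReal.ofReal (F x / (A + normSq x) ^ 2) +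
          (δ₀⁻¹).toNNReal * ENNReal.ofReal (F x - F x / (A + normSq x) ^ 2) := by
            gcongr
            exact hsup x
      _ ≤ _ := by
        rw [← mul_add]
        gcongr
        have h1 : 0 ≤ F x / (A + normSq x) ^ 2 := by have := hFpos x; positivity
        have h2 : F x / (A + normSq x) ^ 2 ≤ F x := by
          refine div_le_self (hFpos x).le ?_
          have := normSq_nonneg x
          exact one_le_pow₀ (by linarith)
        rw [← ENNReal.ofReal_add h1 (by linarith)]
        simp
  have hfin : ∀ x y : Lattice d, walkGreen x y ≠ ∞ := by
    intro x y
    rw [walkGreen_eq]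
    refine ne_top_of_le_ne_top ?_ (upper _)
    finiteness
  set G : Lattice d → ℝ := fun x => F x + M * radial A (p + 1) x with hG
  have hG0 : ∀ x, 0 ≤ G x := fun x => by
    have := hFpos x
    have := radial_pos hA0 (p + 1) x
    positivity
  -- off the finite set `B`, the function `G` is subharmonic
  let B : Finset (Lattice d) := (finite_normSq_le (d := d) R).toFinset
  have hGle : ∀ (ε : ℝ) (x : Lattice d), 0 < ε → ε⁻¹ ^ (1 / p) ≤ A + normSq x →
      F x ≤ ε := by
    intro ε x hε hx
    have hs : 0 < A + normSq x := by have := normSq_nonneg x; linarith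
    have : ε⁻¹ ≤ (A + normSq x) ^ p := by
      calc ε⁻¹ = (ε⁻¹ ^ (1 / p)) ^ p := by
            rw [← Real.rpow_mul (by positivity), one_div_mul_cancel hp0.ne', Real.rpow_one]
        _ ≤ _ := Real.rpow_le_rpow (by positivity) hx hp0.le
    rw [hF, radial, Real.rpow_neg hs.le]
    exact inv_le_of_inv_le₀ hε this
  have hGF : ∀ x, G x ≤ (1 + M) * F x := by
    intro x
    have hs : 1 ≤ A + normSq x := by have := normSq_nonneg x; linarith
    have : radial A (p + 1) x ≤ F x :=
      Real.rpow_le_rpow_of_exponent_le hs (by linarith)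
    have := mul_le_mul_of_nonneg_left this hM
    simp only [hG]
    linarith
  have hF1 : ∀ x, F x ≤ 1 := fun x => by
    refine Real.rpow_le_one_of_one_le_of_nonpos ?_ (by linarith)
    have := normSq_nonneg x; linarith
  have hG1 : ∀ x, G x ≤ 1 + M := fun x => (hGF x).trans (by nlinarith [hF1 x])
  set f : Lattice d → ℝ≥0∞ := fun x => ∑' y : B, ENNReal.ofReal (1 + M) *
    (Pi.single (y : Lattice d) 1 : Lattice d → ℝ≥0∞) x with hf
  have hindicator : ∀ (B : Finset (Lattice d)) (x), x ∈ B →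
      1 ≤ ∑' y : B, (Pi.single (y : Lattice d) 1 : Lattice d → ℝ≥0∞) x := by
    intro B x hx
    refine le_trans ?_ (ENNReal.le_tsum ⟨x, hx⟩)
    simp
  have hsubsol : ∀ x, ENNReal.ofReal (G x) ≤
      f x + transition (fun x => ENNReal.ofReal (G x)) x := by
    intro x
    by_cases hx : x ∈ B
    · refine le_trans ?_ le_self_add
      rw [hf]
      simp only [ENNReal.tsum_mul_left]
      calc ENNReal.ofReal (G x) ≤ ENNReal.ofReal (1 + M) * 1 := by
            rw [mul_one]; exact ENNReal.ofReal_le_ofReal (hG1 x)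
        _ ≤ _ := by gcongr; exact hindicator B x hx
    · refine le_trans ?_ le_add_self
      rw [transition_ofReal G hG0]
      refine ENNReal.ofReal_le_ofReal ?_
      have hx' : R ≤ normSq x := by
        by_contra hlt
        exact hx (by simpa [B] using (not_le.mp hlt).le)
      refine (hsub x hx').trans (le_of_eq ?_)
      simp only [average, hG, hF]
      rw [Finset.mul_sum, ← Finset.sum_add_distrib]
      exact Finset.sum_congr rfl fun _ _ => by ring
  have hGf : ∀ x, ENNReal.ofReal (G x) ≤ potential f x := by
    intro x
    refine ENNReal.le_of_forall_pos_le_add fun ε hε _ => ?_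
    have hM1 : 0 < 1 + M := by linarith
    set ε' : ℝ := ε / (1 + M) with hε'
    have hε'pos : 0 < ε' := by positivity
    let B' : Finset (Lattice d) := (finite_normSq_le (d := d) (ε'⁻¹ ^ (1 / p))).toFinset
    have hG' : (fun x => ENNReal.ofReal (G x)) ≤ (fun _ => (ε : ℝ≥0∞)) +
        fun x => ENNReal.ofReal (1 + M) *
          ∑' y : B', (Pi.single (y : Lattice d) 1 : Lattice d → ℝ≥0∞) x := by
      intro x
      rw [Pi.add_apply]
      by_cases hx : x ∈ B'
      · refine le_trans ?_ le_add_self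
        calc ENNReal.ofReal (G x) ≤ ENNReal.ofReal (1 + M) * 1 := by
              rw [mul_one]; exact ENNReal.ofReal_le_ofReal (hG1 x)
          _ ≤ _ := by gcongr; exact hindicator B' x hx
      · refine le_trans ?_ le_self_add
        rw [← ENNReal.ofReal_coe_nnreal]
        refine ENNReal.ofReal_le_ofReal ?_
        have hx' : ε'⁻¹ ^ (1 / p) ≤ A + normSq x := by
          have : ε'⁻¹ ^ (1 / p) < normSq x := by simpa [B'] using hx
          linarith
        calc G x ≤ (1 + M) * F x := hGF x
          _ ≤ (1 + M) * ε' := by gcongr; exact hGle ε' x hε'pos hx'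
          _ = ε := by rw [hε']; field_simp
    -- `G` is at most `ε` off the finite set `B'`, which the walk leaves for ever
    have hiter : ∀ n, transition^[n] (fun x => ENNReal.ofReal (G x)) x ≤
        ε + ENNReal.ofReal (1 + M) *
          ∑ y : B', transition^[n] (Pi.single (y : Lattice d) 1 : Lattice d → ℝ≥0∞) x := by
      intro n
      refine (iterate_transition_mono n hG' x).trans (le_of_eq ?_)
      simp only [iterate_transition_add, iterate_transition_const, iterate_transition_const_mul,
        iterate_transition_tsum, Pi.add_apply]
      rw [tsum_fintype]
    have hlim : Filter.Tendsto (fun n => potential f x + (ε + ENNReal.ofReal (1 + M) *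
        ∑ y : B', transition^[n] (Pi.single (y : Lattice d) 1 : Lattice d → ℝ≥0∞) x))
        Filter.atTop (nhds (potential f x + (ε + ENNReal.ofReal (1 + M) * ∑ y : B', 0))) := by
      refine tendsto_const_nhds.add (tendsto_const_nhds.add (ENNReal.Tendsto.const_mul
        (tendsto_finsetSum _ fun y _ => ?_) (Or.inr ENNReal.ofReal_ne_top)))
      exact ENNReal.tendsto_atTop_zero_of_tsum_ne_top (hfin x y)
    simp only [Finset.sum_const_zero, mul_zero, add_zero] at hlim
    refine ge_of_tendsto' hlim fun n => ?_
    refine (le_potential_add_iterate hsubsol n x).trans ?_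
    gcongr
    exact hiter n
  choose K hK using fun b : Lattice d => exists_walkGreen_translate_le b
  refine ⟨A, (1 + M).toNNReal * ∑ y : B, K (-y), (δ₀⁻¹).toNNReal, hA, upper, fun x => ?_⟩
  have hFG : F x ≤ G x := by
    have := radial_pos hA0 (p + 1) x
    simp only [hG]
    nlinarith
  refine (ENNReal.ofReal_le_ofReal hFG).trans ((hGf x).trans ?_)
  rw [hf, potential_tsum]
  simp only [potential_const_mul]
  rw [ENNReal.tsum_mul_left, tsum_fintype]
  push_cast
  rw [mul_assoc, Finset.sum_mul]
  refine mul_le_mul' le_rfl (Finset.sum_le_sum fun y _ => ?_)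
  have := hK (-(y : Lattice d)) x
  rw [← sub_eq_add_neg, ← walkGreen_eq] at this
  exact this

end GreenBounds

/-! ### The three Green's functions inequality -/

section ThreeGreen

variable {d : ℕ}

lemma normSq_sub_le (x y z : Lattice d) :
    normSq (x - z) ≤ 2 * (normSq (x - y) + normSq (y - z)) := by
  simp only [normSq]
  rw [← Finset.sum_add_distrib, Finset.mul_sum]
  refine Finset.sum_le_sum fun i _ => ?_
  simp only [Pi.sub_apply, Int.cast_sub]
  nlinarith [sq_nonneg ((x i : ℝ) - y i - (y i - z i))]

lemma radial_le_of_le {A p : ℝ} (hA : 0 < A) (hp : 0 ≤ p) {a b : Lattice d}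
    (h : A + normSq a ≤ 4 * (A + normSq b)) : radial A p b ≤ 4 ^ p * radial A p a := by
  have ha : 0 < A + normSq a := by have := normSq_nonneg a; linarith
  have hb : 0 < A + normSq b := by have := normSq_nonneg b; linarith
  have : radial A p b = 4 ^ p * (4 * (A + normSq b)) ^ (-p) := by
    rw [Real.mul_rpow (by norm_num) hb.le, ← mul_assoc, ← Real.rpow_add (by norm_num)]
    simp [radial]
  rw [this]
  gcongr
  exact Real.rpow_le_rpow_of_nonpos ha h (by linarith)

lemma normSq_neg (x : Lattice d) : normSq (-x) = normSq x := by
  simp [normSq]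

variable [NeZero d]

/-- The Green's function is comparable to the inverse of a quasi-metric, hence almost symmetric, and
it satisfies the three Green's functions inequality: the larger of the distances from `x` to `y` and
from `y` to `z` is at least a fixed multiple of the distance from `x` to `z`. -/
lemma exists_walkGreen_mul_le (hd : 3 ≤ d) : ∃ C : ℝ≥0,
    (∀ x y : Lattice d, walkGreen x y ≤ C * walkGreen y x) ∧
    ∀ x y z : Lattice d, walkGreen x y * walkGreen y z ≤
      C * walkGreen x z * (walkGreen x y + walkGreen y z) := by
  obtain ⟨A, c, C, hA, hup, hlow⟩ := exists_walkGreen_bounds hd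
  set p : ℝ := ((d : ℝ) - 2) / 2 with hp
  have hA0 : 0 < A := by linarith
  have hp0 : 0 ≤ p := by
    have hd3 : (3 : ℝ) ≤ d := by exact_mod_cast hd
    rw [hp]; linarith
  have hcomp : ∀ a b : Lattice d, A + normSq a ≤ 4 * (A + normSq b) →
      walkGreen b 0 ≤ (C * 4 ^ p * c : ℝ≥0) * walkGreen a 0 := by
    intro a b h
    have h4 : ENNReal.ofReal (4 ^ p) = ((4 ^ p : ℝ≥0) : ℝ≥0∞) := by
      rw [← ENNReal.ofReal_coe_nnreal]; simp
    calc walkGreen b 0 ≤ C * ENNReal.ofReal (radial A p b) := hup b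
      _ ≤ C * ENNReal.ofReal (4 ^ p * radial A p a) := by
        gcongr; exact radial_le_of_le hA0 hp0 h
      _ = C * ((4 ^ p : ℝ≥0) * ENNReal.ofReal (radial A p a)) := by
        rw [ENNReal.ofReal_mul (by positivity), h4]
      _ ≤ C * ((4 ^ p : ℝ≥0) * (c * walkGreen a 0)) := by gcongr; exact hlow a
      _ = _ := by push_cast; ring
  refine ⟨C * 4 ^ p * c, fun x y => ?_, fun x y z => ?_⟩
  · rw [walkGreen_eq x y, walkGreen_eq y x]
    apply hcomp
    rw [← neg_sub, normSq_neg]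
    have := normSq_nonneg (x - y)
    linarith
  · have hxz := normSq_sub_le x y z
    rcases le_total (normSq (x - y)) (normSq (y - z)) with h | h
    · have h' := hcomp (x - z) (y - z) (by linarith)
      rw [← walkGreen_eq, ← walkGreen_eq] at h'
      calc _ ≤ walkGreen x y * ((C * 4 ^ p * c : ℝ≥0) * walkGreen x z) := by gcongr
        _ = (C * 4 ^ p * c : ℝ≥0) * walkGreen x z * walkGreen x y := by ring
        _ ≤ _ := by gcongr; exact le_self_add
    · have h' := hcomp (x - z) (x - y) (by linarith)
      rw [← walkGreen_eq, ← walkGreen_eq] at h'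
      calc _ ≤ ((C * 4 ^ p * c : ℝ≥0) * walkGreen x z) * walkGreen y z := by gcongr
        _ ≤ _ := by gcongr; exact le_add_self

/-- The quadratic estimate behind the fixed point argument: the potential of `(gφ)²` is bounded
by `gφ` times the supremum of `ggφ`. Here `g` is the potential operator. -/
lemma exists_potential_sq_le (hd : 3 ≤ d) : ∃ C : ℝ≥0, ∀ (f : Lattice d → ℝ≥0∞) (κ : ℝ≥0∞),
    (∀ x, potential (potential f) x ≤ κ) →
      ∀ x, potential (fun y => potential f y ^ 2) x ≤ C * κ * potential f x := by
  obtain ⟨C, hsymm, hmul⟩ := exists_walkGreen_mul_le hd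
  refine ⟨C * (1 + C), fun f κ hκ x => ?_⟩
  have h1 : ∑' y, walkGreen x y * potential f y ≤ κ := by
    rw [← potential_eq_tsum_walkGreen]; exact hκ x
  have h2 : ∀ z, ∑' y, walkGreen y z * potential f y ≤ C * κ := fun z => by
    calc _ ≤ ∑' y, C * walkGreen z y * potential f y :=
          ENNReal.tsum_le_tsum fun y => by gcongr; exact hsymm y z
      _ = C * potential (potential f) z := by
        rw [potential_eq_tsum_walkGreen (potential f), ← ENNReal.tsum_mul_left]
        exact tsum_congr fun y => by ring
      _ ≤ _ := by gcongr; exact hκ z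
  calc potential (fun y => potential f y ^ 2) x
      = ∑' y, ∑' z, walkGreen x y * walkGreen y z * f z * potential f y := by
        rw [potential_eq_tsum_walkGreen]
        refine tsum_congr fun y => ?_
        rw [sq, ← mul_assoc]
        nth_rw 1 [potential_eq_tsum_walkGreen f y]
        rw [← ENNReal.tsum_mul_left, ← ENNReal.tsum_mul_right]
        exact tsum_congr fun z => by ring
    _ ≤ ∑' y, ∑' z, C * walkGreen x z * f z *
          (walkGreen x y * potential f y + walkGreen y z * potential f y) := by
        refine ENNReal.tsum_le_tsum fun y => ENNReal.tsum_le_tsum fun z => ?_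
        refine (mul_le_mul' (mul_le_mul' (hmul x y z) le_rfl) le_rfl).trans (le_of_eq ?_)
        ring
    _ = ∑' z, C * walkGreen x z * f z *
          ((∑' y, walkGreen x y * potential f y) + ∑' y, walkGreen y z * potential f y) := by
        rw [ENNReal.tsum_comm]
        refine tsum_congr fun z => ?_
        rw [ENNReal.tsum_mul_left, ENNReal.tsum_add]
    _ ≤ ∑' z, C * walkGreen x z * f z * (κ + C * κ) := by
        refine ENNReal.tsum_le_tsum fun z => ?_
        gcongr
        exact h2 z
    _ = _ := by
        rw [ENNReal.tsum_mul_right, potential_eq_tsum_walkGreen f x]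
        simp only [mul_assoc, ENNReal.tsum_mul_left]
        push_cast
        ring

end ThreeGreen

/-! ### Generating functions of the offspring laws near one -/

section Moments

/-- Second-order convexity bound: `((1 + z) ^ m - 1 - m z) / z ^ 2` is nondecreasing in `z`. -/
lemma one_add_pow_le_quadratic {z b : ℝ} (hz : 0 ≤ z) (hzb : z ≤ b) (m : ℕ) :
    b ^ 2 * (1 + z) ^ m ≤ b ^ 2 * (1 + m * z) + z ^ 2 * (1 + b) ^ m := by
  have key : ∀ m : ℕ, 0 ≤ (1 + b) ^ m - 1 - m * b ∧
      b ^ 2 * ((1 + z) ^ m - 1 - m * z) ≤ z ^ 2 * ((1 + b) ^ m - 1 - m * b) := by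
    intro m
    induction m with
    | zero => simp
    | succ m ih =>
      obtain ⟨h0, h⟩ := ih
      have hrec : ∀ c : ℝ, (1 + c) ^ (m + 1) - 1 - ((m + 1 : ℕ) : ℝ) * c =
          (1 + c) * ((1 + c) ^ m - 1 - m * c) + m * c ^ 2 := by
        intro c; push_cast; ring
      rw [hrec, hrec]
      have hb : 0 ≤ b := hz.trans hzb
      refine ⟨by positivity, ?_⟩
      have : (1 + z) * (b ^ 2 * ((1 + z) ^ m - 1 - m * z)) ≤
          (1 + b) * (z ^ 2 * ((1 + b) ^ m - 1 - m * b)) :=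
        calc _ ≤ (1 + z) * (z ^ 2 * ((1 + b) ^ m - 1 - m * b)) := by gcongr
          _ ≤ _ := by gcongr
      linarith
  have := (key m).2
  have h1 : 0 ≤ z ^ 2 * (1 + m * b) := by
    have : 0 ≤ b := hz.trans hzb
    positivity
  linarith

/-- First-order convexity bound: `((1 + z) ^ j - 1) / z` is nondecreasing in `z`. -/
lemma one_add_pow_le_chord {z b : ℝ} (hz : 0 ≤ z) (hzb : z ≤ b) (j : ℕ) :
    b * (1 + z) ^ j ≤ b + z * (1 + b) ^ j := by
  have key : ∀ j : ℕ, 0 ≤ (1 + b) ^ j - 1 ∧ b * ((1 + z) ^ j - 1) ≤ z * ((1 + b) ^ j - 1) := by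
    intro j
    induction j with
    | zero => simp
    | succ j ih =>
      obtain ⟨h0, h⟩ := ih
      have hrec : ∀ c : ℝ, (1 + c) ^ (j + 1) - 1 = (1 + c) * ((1 + c) ^ j - 1) + c := by
        intro c; ring
      rw [hrec, hrec]
      have hb : 0 ≤ b := hz.trans hzb
      refine ⟨by positivity, ?_⟩
      have : (1 + z) * (b * ((1 + z) ^ j - 1)) ≤ (1 + b) * (z * ((1 + b) ^ j - 1)) :=
        calc _ ≤ (1 + z) * (z * ((1 + b) ^ j - 1)) := by gcongr
          _ ≤ _ := by gcongr
      linarith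
  have := (key j).2
  linarith

/-- The derivative of a power at `1 + b` is controlled by the power at `1 + 2 b`. -/
lemma mul_pow_pred_le {b : ℝ} (hb : 0 ≤ b) (k : ℕ) :
    b * (k * (1 + b) ^ (k - 1)) ≤ (1 + 2 * b) ^ k := by
  have key : ∀ k : ℕ, b * ((k + 1 : ℕ) * (1 + b) ^ k) ≤ (1 + 2 * b) ^ (k + 1) := by
    intro k
    induction k with
    | zero => simp; linarith
    | succ k ih =>
      have h1 : (1 + b) ^ (k + 1) ≤ (1 + 2 * b) ^ (k + 1) := by gcongr; linarith
      calc b * ((k + 1 + 1 : ℕ) * (1 + b) ^ (k + 1))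
          = (1 + b) * (b * ((k + 1 : ℕ) * (1 + b) ^ k)) + b * (1 + b) ^ (k + 1) := by
            push_cast; ring
        _ ≤ (1 + b) * (1 + 2 * b) ^ (k + 1) + b * (1 + 2 * b) ^ (k + 1) := by gcongr
        _ = _ := by ring
  rcases k with _ | k
  · simp
  · simpa using key k

/-- With a finite exponential moment, the generating functions of `μ` and of the size-biased law
are controlled near `1` to second and to first order respectively. -/
lemma exists_generating_function_bounds (μ : PMF ℕ) (hmean : ∑' i : ℕ, (i : ℝ≥0∞) * μ i = 1)
    (hexp : ∃ l : ℝ, 0 < l ∧ ∑' i : ℕ, ENNReal.ofReal (Real.exp (l * i)) * μ i < ⊤) :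
    ∃ b C : ℝ≥0, 0 < b ∧ ∀ z : ℝ≥0∞, z ≤ b →
      ∑' m : ℕ, μ m * (1 + z) ^ m ≤ 1 + z + C * z ^ 2 ∧
      ∑' k : ℕ, (k : ℝ≥0∞) * μ k * (1 + z) ^ (k - 1) ≤ 1 + C * z := by
  obtain ⟨l, hl, hfin⟩ := hexp
  have hl1 : 0 < (Real.exp l - 1) / 2 := by
    have := Real.add_one_lt_exp hl.ne'
    linarith
  -- `1 + 2 b = exp l`, so that the exponential moment is the generating function at `1 + 2 b`
  set b : ℝ≥0 := ((Real.exp l - 1) / 2).toNNReal with hb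
  have hb0 : 0 < b := Real.toNNReal_pos.mpr hl1
  have hbl : 1 + 2 * (b : ℝ) = Real.exp l := by
    rw [hb, Real.coe_toNNReal _ hl1.le]; ring
  set M := ∑' i : ℕ, ENNReal.ofReal (Real.exp (l * i)) * μ i with hM
  have hMeq : M = ∑' i : ℕ, μ i * (1 + 2 * b : ℝ≥0) ^ i := by
    refine tsum_congr fun i => ?_
    rw [mul_comm, mul_comm l, Real.exp_nat_mul, ← hbl, ENNReal.ofReal_pow (by positivity),
      ← ENNReal.ofReal_coe_nnreal]
    simp
  lift M to ℝ≥0 using hfin.ne with M' hM'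
  refine ⟨b, b⁻¹ ^ 2 * M', hb0, fun z hz => ?_⟩
  lift z to ℝ≥0 using ne_top_of_le_ne_top ENNReal.coe_ne_top hz
  have hz : z ≤ b := by exact_mod_cast hz
  constructor
  · have h : ∀ m : ℕ, ((1 + z : ℝ≥0) : ℝ≥0∞) ^ m ≤
        1 + m * z + (z ^ 2 * b⁻¹ ^ 2 : ℝ≥0) * (1 + 2 * b : ℝ≥0) ^ m := by
      intro m
      have h1 : (1 + z) ^ m ≤ 1 + m * z + z ^ 2 * b⁻¹ ^ 2 * (1 + 2 * b) ^ m := by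
        have h2 : b ^ 2 * (1 + z) ^ m ≤ b ^ 2 * (1 + m * z) + z ^ 2 * (1 + b) ^ m :=
          one_add_pow_le_quadratic (b := b) z.2 hz m
        have h3 : (1 + b) ^ m ≤ (1 + 2 * b) ^ m := by
          gcongr; rw [two_mul]; exact le_self_add
        have h4 : b ^ 2 * (1 + z) ^ m ≤
            b ^ 2 * (1 + m * z + z ^ 2 * b⁻¹ ^ 2 * (1 + 2 * b) ^ m) := by
          calc _ ≤ b ^ 2 * (1 + m * z) + z ^ 2 * (1 + 2 * b) ^ m := h2.trans (by gcongr)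
            _ = _ := by field_simp
        exact le_of_mul_le_mul_left h4 (by positivity)
      exact_mod_cast h1
    calc ∑' m : ℕ, μ m * (1 + (z : ℝ≥0∞)) ^ m
        ≤ ∑' m : ℕ, (μ m + z * (m * μ m) +
            (z ^ 2 * b⁻¹ ^ 2 : ℝ≥0) * (μ m * (1 + 2 * b : ℝ≥0) ^ m)) := by
          refine ENNReal.tsum_le_tsum fun m => ?_
          calc _ = μ m * ((1 + z : ℝ≥0) : ℝ≥0∞) ^ m := by push_cast; rfl
            _ ≤ μ m * (1 + m * z + (z ^ 2 * b⁻¹ ^ 2 : ℝ≥0) * (1 + 2 * b : ℝ≥0) ^ m) := by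
              gcongr; exact h m
            _ = _ := by ring
      _ = 1 + z + (z ^ 2 * b⁻¹ ^ 2 : ℝ≥0) * M' := by
          rw [ENNReal.tsum_add, ENNReal.tsum_add, ENNReal.tsum_mul_left, ENNReal.tsum_mul_left,
            hmean, μ.tsum_coe, ← hMeq, mul_one]
      _ = _ := by push_cast; ring
  · have h : ∀ k : ℕ, (k : ℝ≥0∞) * ((1 + z : ℝ≥0) : ℝ≥0∞) ^ (k - 1) ≤
        k + (z * b⁻¹ ^ 2 : ℝ≥0) * (1 + 2 * b : ℝ≥0) ^ k := by
      intro k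
      have h1 : (k : ℝ≥0) * (1 + z) ^ (k - 1) ≤ k + z * b⁻¹ ^ 2 * (1 + 2 * b) ^ k := by
        have h2 : b * (1 + z) ^ (k - 1) ≤ b + z * (1 + b) ^ (k - 1) :=
          one_add_pow_le_chord (b := b) z.2 hz (k - 1)
        have h3 : b * (k * (1 + b) ^ (k - 1)) ≤ (1 + 2 * b) ^ k := mul_pow_pred_le b.2 k
        have h4 : b ^ 2 * (k * (1 + z) ^ (k - 1)) ≤
            b ^ 2 * (k + z * b⁻¹ ^ 2 * (1 + 2 * b) ^ k) := by
          calc _ = k * b * (b * (1 + z) ^ (k - 1)) := by ring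
            _ ≤ k * b * (b + z * (1 + b) ^ (k - 1)) := by gcongr
            _ = b ^ 2 * k + z * (b * (k * (1 + b) ^ (k - 1))) := by ring
            _ ≤ b ^ 2 * k + z * (1 + 2 * b) ^ k := by gcongr
            _ = _ := by field_simp
        exact le_of_mul_le_mul_left h4 (by positivity)
      exact_mod_cast h1
    calc ∑' k : ℕ, (k : ℝ≥0∞) * μ k * (1 + (z : ℝ≥0∞)) ^ (k - 1)
        ≤ ∑' k : ℕ, (k * μ k + (z * b⁻¹ ^ 2 : ℝ≥0) * (μ k * (1 + 2 * b : ℝ≥0) ^ k)) := by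
          refine ENNReal.tsum_le_tsum fun k => ?_
          calc _ = μ k * (k * ((1 + z : ℝ≥0) : ℝ≥0∞) ^ (k - 1)) := by push_cast; ring
            _ ≤ μ k * (k + (z * b⁻¹ ^ 2 : ℝ≥0) * (1 + 2 * b : ℝ≥0) ^ k) := by
              gcongr; exact h k
            _ = _ := by ring
      _ = 1 + (z * b⁻¹ ^ 2 : ℝ≥0) * M' := by
          rw [ENNReal.tsum_add, ENNReal.tsum_mul_left, hmean, ← hMeq]
      _ = _ := by push_cast; ring

end Moments

/-! ### The exponential function on extended nonnegative reals -/

section Exponential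

/-- The exponential function on `[0, ∞]`. -/
noncomputable def expENN (a : ℝ≥0∞) : ℝ≥0∞ := EReal.exp (a : EReal)

@[simp] lemma expENN_zero : expENN 0 = 1 := by simp [expENN]

lemma expENN_add (a b : ℝ≥0∞) : expENN (a + b) = expENN a * expENN b := by
  rw [expENN, EReal.coe_ennreal_add, EReal.exp_add]
  rfl

lemma expENN_mono : Monotone expENN := fun _ _ h =>
  EReal.exp_monotone (EReal.coe_ennreal_le_coe_ennreal_iff.mpr h)

lemma expENN_sum {ι : Type*} (s : Finset ι) (f : ι → ℝ≥0∞) :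
    expENN (∑ i ∈ s, f i) = ∏ i ∈ s, expENN (f i) := by
  classical
  induction s using Finset.induction_on with
  | empty => simp
  | insert i s hi ih => rw [Finset.sum_insert hi, Finset.prod_insert hi, expENN_add, ih]

lemma continuous_expENN : Continuous expENN :=
  EReal.expHomeomorph.continuous.comp continuous_coe_ennreal_ereal

lemma expENN_le {a : ℝ≥0∞} (ha : a ≤ 1) : expENN a ≤ 1 + 2 * a := by
  lift a to ℝ≥0 using ne_top_of_le_ne_top ENNReal.one_ne_top ha
  have ha : (a : ℝ) ≤ 1 := by exact_mod_cast ha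
  have h := Real.abs_exp_sub_one_le (x := a) (by rwa [NNReal.abs_eq])
  have h' : Real.exp a ≤ 1 + 2 * a := by
    have := (abs_le.mp h).2
    rw [NNReal.abs_eq] at this
    linarith
  have : expENN a = ENNReal.ofReal (Real.exp a) := by
    rw [expENN, EReal.coe_nnreal_eq_coe_real, EReal.exp_coe]
  rw [this]
  refine (ENNReal.ofReal_le_ofReal h').trans (le_of_eq ?_)
  rw [ENNReal.ofReal_add zero_le_one (by positivity), ENNReal.ofReal_mul (by norm_num)]
  simp

end Exponential

/-! ### Supersolutions of the branching equations -/

section Supersolution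

variable {d : ℕ} [NeZero d]

/-- If the iterated potential `ggφ` is uniformly small, there are small functions `H` and `W` which
are supersolutions of the recursive equations satisfied by the exponential moments of the normal
and of the special subtrees. Here `H = g (6 φ + 49 C (gφ)²)` and `W = g (8 φ + 14 C gφ)`, with `C`
from the bounds on the generating functions; the three Green's functions inequality gives
`H ≤ 7 gφ`, and this bound makes the recursion for `H` close. -/
lemma exists_supersolutions (hd : 3 ≤ d) (μ : PMF ℕ) (hmean : ∑' i : ℕ, (i : ℝ≥0∞) * μ i = 1)
    (hexp : ∃ l : ℝ, 0 < l ∧ ∑' i : ℕ, ENNReal.ofReal (Real.exp (l * i)) * μ i < ⊤) :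
    ∃ ε : ℝ≥0, 0 < ε ∧ ∀ f : Lattice d → ℝ≥0∞, (∀ x, potential (potential f) x ≤ ε) →
      ∃ H W : Lattice d → ℝ≥0∞, (∀ x, H x ≤ 4⁻¹) ∧ (∀ x, W x ≤ 4⁻¹) ∧
        (∀ x, transition W x ≤ W x) ∧
        (∀ x, expENN (f x) * ∑' m : ℕ, μ m * (1 + transition H x) ^ m ≤ 1 + H x) ∧
        ∀ x, expENN (f x) * (∑' k : ℕ, (k : ℝ≥0∞) * μ k * (1 + transition H x) ^ (k - 1)) *
          (1 + transition W x) ≤ 1 + W x := by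
  obtain ⟨b, C, hb, hgen⟩ := exists_generating_function_bounds μ hmean hexp
  obtain ⟨C₃, hC₃⟩ := exists_potential_sq_le hd (d := d)
  -- each summand of `D` is the constant in one of the smallness conditions below
  set D : ℝ≥0 := 49 * C * C₃ + 7 * b⁻¹ + 28 + 7 * C + 32 + 56 * C with hD
  have hD0 : 0 < D := by positivity
  have small : ∀ a : ℝ≥0, a ≤ D → (a : ℝ≥0∞) * ((D⁻¹ : ℝ≥0) : ℝ≥0∞) ≤ 1 := by
    intro a ha
    have : a * D⁻¹ ≤ 1 := by
      calc a * D⁻¹ ≤ D * D⁻¹ := by gcongr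
        _ = 1 := mul_inv_cancel₀ hD0.ne'
    exact_mod_cast this
  have s1 := small (49 * C * C₃) (by
    rw [hD]; simp only [add_assoc]; exact le_self_add)
  have s2 := small (7 * b⁻¹) (by
    rw [hD]; simp only [add_assoc]; exact le_add_left le_self_add)
  have s3 := small 28 (by
    rw [hD]; simp only [add_assoc]; exact le_add_left (le_add_left le_self_add))
  have s4 := small (7 * C) (by
    rw [hD]; simp only [add_assoc]; exact le_add_left (le_add_left (le_add_left le_self_add)))
  have s5 := small (32 + 56 * C) (by rw [hD, add_assoc]; exact le_add_self)
  refine ⟨D⁻¹, by positivity, fun f hf => ?_⟩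
  set ε : ℝ≥0∞ := ((D⁻¹ : ℝ≥0) : ℝ≥0∞) with hε
  set h := potential f with hh
  have hhε : ∀ x, h x ≤ ε := fun x => (le_potential h x).trans (hf x)
  have hfh : ∀ x, f x ≤ h x := le_potential f
  have hPh : ∀ x, transition h x ≤ h x := transition_potential_le f
  set ψ : Lattice d → ℝ≥0∞ := (fun x => 6 * f x) + fun x => (49 * C : ℝ≥0∞) * h x ^ 2 with hψ
  set θ : Lattice d → ℝ≥0∞ := (fun x => 8 * f x) + fun x => (14 * C : ℝ≥0∞) * h x with hθ
  have hH : ∀ x, potential ψ x ≤ 7 * h x := by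
    intro x
    rw [hψ, potential_add, potential_const_mul, potential_const_mul, Pi.add_apply]
    calc 6 * potential f x + 49 * C * potential (fun x => h x ^ 2) x
        ≤ 6 * h x + 49 * C * (C₃ * ε * h x) := by gcongr; exact hC₃ f ε hf x
      _ = 6 * h x + ((49 * C * C₃ : ℝ≥0) : ℝ≥0∞) * ε * h x := by push_cast; ring
      _ ≤ 6 * h x + 1 * h x := by gcongr
      _ = 7 * h x := by ring
  have hH4 : ∀ x, 7 * h x ≤ 4⁻¹ := by
    intro x
    rw [ENNReal.le_inv_iff_mul_le]
    calc 7 * h x * 4 ≤ 7 * ε * 4 := by gcongr; exact hhε x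
      _ = 28 * ε := by ring
      _ ≤ 1 := by simpa using s3
  have hW4 : ∀ x, potential θ x ≤ 4⁻¹ := by
    intro x
    rw [hθ, potential_add, potential_const_mul, potential_const_mul, Pi.add_apply,
      ENNReal.le_inv_iff_mul_le]
    calc (8 * potential f x + 14 * C * potential h x) * 4
        ≤ (8 * ε + 14 * C * ε) * 4 := by
          gcongr
          · exact hhε x
          · exact hf x
      _ = ((32 + 56 * C : ℝ≥0) : ℝ≥0∞) * ε := by push_cast; ring
      _ ≤ 1 := s5
  have h41 : (4⁻¹ : ℝ≥0∞) ≤ 1 := by simp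
  have hz7 : ∀ x, transition (potential ψ) x ≤ 7 * h x := fun x =>
    calc transition (potential ψ) x ≤ transition (fun x => 7 * h x) x := transition_mono hH x
      _ = 7 * transition h x := by rw [transition_const_mul]
      _ ≤ 7 * h x := by gcongr; exact hPh x
  have hzb : ∀ x, transition (potential ψ) x ≤ b := by
    intro x
    refine (hz7 x).trans ?_
    have hbb : (b : ℝ≥0∞) * ((b⁻¹ : ℝ≥0) : ℝ≥0∞) = 1 := by
      rw [← ENNReal.coe_mul, mul_inv_cancel₀ hb.ne', ENNReal.coe_one]
    calc 7 * h x ≤ 7 * ε := by gcongr; exact hhε x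
      _ = b * (((7 * b⁻¹ : ℝ≥0) : ℝ≥0∞) * ε) := by
        push_cast
        calc 7 * ε = (b * ((b⁻¹ : ℝ≥0) : ℝ≥0∞)) * (7 * ε) := by rw [hbb, one_mul]
          _ = _ := by ring
      _ ≤ b * 1 := by gcongr
      _ = b := mul_one _
  have hCz : ∀ x, C * transition (potential ψ) x ≤ 1 := fun x =>
    calc C * transition (potential ψ) x ≤ C * (7 * ε) := by
          gcongr; exact (hz7 x).trans (by gcongr; exact hhε x)
      _ = ((7 * C : ℝ≥0) : ℝ≥0∞) * ε := by push_cast; ring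
      _ ≤ 1 := s4
  have hf1 : ∀ x, f x ≤ 1 := fun x => by
    refine (hfh x).trans (le_trans ?_ ((hH4 x).trans h41))
    calc h x = 1 * h x := (one_mul _).symm
      _ ≤ 7 * h x := by gcongr; norm_num
  refine ⟨potential ψ, potential θ, fun x => (hH x).trans (hH4 x), hW4,
    transition_potential_le θ, fun x => ?_, fun x => ?_⟩
  · set z := transition (potential ψ) x with hz
    have hz1 : z ≤ 1 := (hz7 x).trans ((hH4 x).trans h41)
    calc _ ≤ (1 + 2 * f x) * (1 + z + C * z ^ 2) :=
          mul_le_mul' (expENN_le (hf1 x)) (hgen z (hzb x)).1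
      _ = 1 + z + C * z ^ 2 + 2 * f x * (1 + z + C * z * z) := by ring
      _ ≤ 1 + z + C * (7 * h x) ^ 2 + 2 * f x * (1 + 1 + 1 * 1) := by
          gcongr
          · exact hz7 x
          · exact hCz x
      _ = 1 + (ψ x + z) := by
          rw [hψ, Pi.add_apply]
          ring
      _ = 1 + potential ψ x := by rw [potential_eq_add_transition ψ x]
  · set z := transition (potential ψ) x with hz
    set w := transition (potential θ) x with hw
    have hw1 : w ≤ 1 := (transition_potential_le θ x).trans ((hW4 x).trans h41)
    calc _ ≤ (1 + 2 * f x) * (1 + C * z) * (1 + w) :=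
          mul_le_mul' (mul_le_mul' (expENN_le (hf1 x)) (hgen z (hzb x)).2) le_rfl
      _ = 1 + w + C * z * (1 + w) + 2 * f x * ((1 + C * z) * (1 + w)) := by ring
      _ ≤ 1 + w + C * (7 * h x) * (1 + 1) + 2 * f x * ((1 + 1) * (1 + 1)) := by
          gcongr
          · exact hz7 x
          · exact hCz x
      _ = 1 + (θ x + w) := by
          rw [hθ, Pi.add_apply]
          ring
      _ = 1 + potential θ x := by rw [potential_eq_add_transition θ x]

end Supersolution

/-! ### Labelled subtrees and their recursive structure -/

section Subtree

/-- The three kinds of vertices of the infinite tree: the root, the other spine vertices, and the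
normal vertices. The root is separate because its offspring has a law of its own. -/
inductive Kind
  | root
  | special
  | normal

/-- Every set of optional kinds is measurable. -/
instance : MeasurableSpace (Option Kind) := ⊤

instance : DiscreteMeasurableSpace (Option Kind) := ⟨fun _ => trivial⟩

instance : Finite Kind :=
  Finite.of_injective (fun k : Kind => match k with
    | .root => (0 : Fin 3)
    | .special => 1
    | .normal => 2) (by intro a b; cases a <;> cases b <;> simp)

variable {d : ℕ}

instance : DiscreteMeasurableSpace (Mark d) := ⟨fun _ => trivial⟩

instance : Countable (Mark d) :=
  Function.Injective.countable
    (f := fun m : Mark d => (m.normalOffspring, m.specialOffspring, m.specialChild, m.step))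
    (by rintro ⟨⟩ ⟨⟩ h; simpa using h)

/-- The kind of the `i`-th child of a vertex of given kind and mark in the tree `𝒯`,
with value `none` if there is no such child. -/
def treeRule (m : Mark d) : Kind → ℕ → Option Kind
  | .root, i => if i < m.normalOffspring + 1 then
      (if i = 0 then some .special else some .normal) else none
  | .special, i => if i < m.specialOffspring then
      (if i = m.specialChild then some .special else some .normal) else none
  | .normal, i => if i < m.normalOffspring then some .normal else none

/-- The kind of the `i`-th child in the past of `𝒯` together with the root: children of spine
vertices that come after the special child are deleted. -/
def pastRule (m : Mark d) : Kind → ℕ → Option Kind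
  | .root, i => if i = 0 then some .special else none
  | .special, i => if i < m.specialOffspring then
      (if i = m.specialChild then some .special
        else if i < m.specialChild then some .normal else none) else none
  | .normal, i => if i < m.normalOffspring then some .normal else none

/-- The kind of the vertex `u` in the tree grown from a vertex of kind `b` by the rule `r`, with
value `none` if `u` does not belong to it. A rule gives the kinds of the children of a vertex in
terms of its mark and kind. -/
def kind (r : Mark d → Kind → ℕ → Option Kind) (ω : Sample d) (b : Kind) : Vertex → Option Kind
  | [] => some b
  | i :: u => (kind r ω b u).bind fun c => r (ω u) c i

/-- The marks of the `i`-th child of the root and of its descendants, viewed as a sample. -/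
def shift (i : ℕ) (ω : Sample d) : Sample d := fun u => ω (u ++ [i])

lemma kind_append (r : Mark d → Kind → ℕ → Option Kind) (ω : Sample d) (b : Kind) (u : Vertex)
    (i : ℕ) : kind r ω b (u ++ [i]) = (r (ω []) b i).bind fun c => kind r (shift i ω) c u := by
  induction u with
  | nil => simp [kind]
  | cons j u ih => simp [kind, ih, Option.bind_assoc, shift]

lemma walk_append (ω : Sample d) (x : Lattice d) (u : Vertex) (i : ℕ) :
    walk ω x (u ++ [i]) = walk (shift i ω) (x + (shift i ω []).step) u := by
  induction u with
  | nil => simp [walk, shift]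
  | cons j u ih =>
    simp only [List.cons_append, walk, ih]
    rfl

lemma append_singleton_injective :
    Function.Injective fun p : ℕ × Vertex => p.2 ++ [p.1] := by
  rintro ⟨i, v⟩ ⟨j, w⟩ h
  obtain ⟨h1, h2⟩ := List.append_inj' h rfl
  simp_all

/-- Decomposition of a sum over all vertices according to the first step away from the root. -/
lemma tsum_vertex (f : Vertex → ℝ≥0∞) :
    ∑' u, f u = f [] + ∑' i : ℕ, ∑' v : Vertex, f (v ++ [i]) := by
  have hrange : Set.range (fun p : ℕ × Vertex => p.2 ++ [p.1]) = {[]}ᶜ := by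
    ext l
    constructor
    · rintro ⟨p, rfl⟩
      simp
    · intro hl
      obtain h | ⟨v, i, rfl⟩ := List.eq_nil_or_concat l
      · exact absurd h hl
      · exact ⟨(i, v), List.concat_eq_append.symm⟩
  rw [← ENNReal.tsum_prod (f := fun i v => f (v ++ [i])),
    ← Summable.tsum_add_tsum_compl (s := {([] : Vertex)}) ENNReal.summable ENNReal.summable,
    tsum_singleton]
  congr 1
  rw [← hrange, tsum_range (g := fun p : ℕ × Vertex => p.2 ++ [p.1]) f append_singleton_injective]

open Classical in
/-- The sum of `f` along the walk started from `x`, over the vertices of generation less than `n`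
of the tree grown by the rule `r` from a root of kind `b`. -/
noncomputable def treeSum (r : Mark d → Kind → ℕ → Option Kind) (f : Lattice d → ℝ≥0∞) (n : ℕ∞)
    (b : Kind) (x : Lattice d) (ω : Sample d) : ℝ≥0∞ :=
  ∑' u : Vertex, if (u.length : ℕ∞) < n ∧ kind r ω b u ≠ none then f (walk ω x u) else 0

/-- The same sum when the increment attached to the root is also performed: the contribution of the
subtree above a vertex whose parent sits at `x`. -/
noncomputable def stepTreeSum (r : Mark d → Kind → ℕ → Option Kind) (f : Lattice d → ℝ≥0∞)
    (n : ℕ∞) (b : Kind) (x : Lattice d) (ω : Sample d) : ℝ≥0∞ :=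
  treeSum r f n b (x + (ω []).step) ω

variable (r : Mark d → Kind → ℕ → Option Kind) (f : Lattice d → ℝ≥0∞)

lemma treeSum_zero (b : Kind) (x : Lattice d) (ω : Sample d) : treeSum r f 0 b x ω = 0 := by
  simp [treeSum]

lemma treeSum_succ (n : ℕ∞) (b : Kind) (x : Lattice d) (ω : Sample d) :
    treeSum r f (n + 1) b x ω = f x +
      ∑' i : ℕ, (r (ω []) b i).elim 0 fun c => stepTreeSum r f n c x (shift i ω) := by
  rw [treeSum, tsum_vertex]
  congr 1
  · have : (0 : ℕ∞) < n + 1 := by simp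
    simp [kind, walk, this]
  · refine tsum_congr fun i => ?_
    rcases h : r (ω []) b i with _ | c
    · simp [kind_append, h]
    · simp only [Option.elim, stepTreeSum, treeSum, kind_append, h, walk_append]
      refine tsum_congr fun v => ?_
      have : (((v ++ [i]).length : ℕ) : ℕ∞) < n + 1 ↔ (v.length : ℕ∞) < n := by
        rw [List.length_append, List.length_singleton, Nat.cast_add, Nat.cast_one]
        exact ENat.add_lt_add_iff_right ENat.one_ne_top
      simp only [this]
      rfl

lemma measurable_kind (b : Kind) (u : Vertex) :
    Measurable fun ω : Sample d => kind r ω b u := by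
  induction u with
  | nil => exact measurable_const
  | cons i u ih =>
    have hg : Measurable fun p : Option Kind × Mark d => p.1.bind fun c => r p.2 c i :=
      measurable_of_countable _
    exact hg.comp (ih.prodMk (measurable_pi_apply u))

lemma measurable_step : Measurable fun m : Mark d => m.step := measurable_of_countable _

lemma measurable_walk (x : Lattice d) (u : Vertex) :
    Measurable fun ω : Sample d => walk ω x u := by
  induction u with
  | nil => exact measurable_const
  | cons i u ih => exact ih.add (measurable_step.comp (measurable_pi_apply (i :: u)))

lemma measurable_treeSum (n : ℕ∞) (b : Kind) (x : Lattice d) :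
    Measurable fun ω : Sample d => treeSum r f n b x ω := by
  classical
  refine Measurable.tsum fun u => ?_
  refine Measurable.ite ?_ ((measurable_of_countable f).comp (measurable_walk x u))
    measurable_const
  exact (MeasurableSet.const _).inter
    (measurable_kind r b u (t := {none}ᶜ) (MeasurableSet.of_discrete))

lemma measurable_stepTreeSum (n : ℕ∞) (b : Kind) (x : Lattice d) :
    Measurable fun ω : Sample d => stepTreeSum r f n b x ω := by
  have h : Measurable fun p : Lattice d × Sample d => treeSum r f n b (x + p.1) p.2 :=
    measurable_from_prod_countable_right fun s => measurable_treeSum r f n b (x + s)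
  exact h.comp ((measurable_step.comp (measurable_pi_apply [])).prodMk measurable_id)

lemma measurable_shift (i : ℕ) : Measurable fun ω : Sample d => shift i ω :=
  measurable_pi_iff.mpr fun u => measurable_pi_apply (u ++ [i])

lemma treeSum_mono {n n' : ℕ∞} (h : n ≤ n') (b : Kind) (x : Lattice d) (ω : Sample d) :
    treeSum r f n b x ω ≤ treeSum r f n' b x ω := by
  classical
  refine ENNReal.tsum_le_tsum fun u => ?_
  by_cases h1 : (u.length : ℕ∞) < n ∧ kind r ω b u ≠ none
  · rw [if_pos h1, if_pos ⟨h1.1.trans_le h, h1.2⟩]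
  · rw [if_neg h1]
    exact zero_le

lemma tendsto_treeSum (b : Kind) (x : Lattice d) (ω : Sample d) :
    Filter.Tendsto (fun n : ℕ => treeSum r f n b x ω) Filter.atTop
      (nhds (treeSum r f ⊤ b x ω)) := by
  classical
  have hmono : Monotone fun n : ℕ => treeSum r f n b x ω := fun n m h =>
    treeSum_mono r f (by exact_mod_cast h) b x ω
  have : treeSum r f ⊤ b x ω = ⨆ n : ℕ, treeSum r f n b x ω := by
    refine le_antisymm ?_ (iSup_le fun n => treeSum_mono r f le_top b x ω)
    rw [treeSum, ENNReal.tsum_eq_iSup_sum]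
    refine iSup_le fun s => le_trans ?_ (le_iSup _ (s.sup List.length + 1))
    refine le_trans (Finset.sum_le_sum fun u hu => ?_) (ENNReal.sum_le_tsum s)
    have hlen : ((u.length : ℕ) : ℕ∞) < ((s.sup List.length + 1 : ℕ) : ℕ∞) := by
      exact_mod_cast Nat.lt_succ_of_le (Finset.le_sup (f := List.length) hu)
    by_cases h : kind r ω b u = none
    · simp [h]
    · rw [if_pos (show _ ∧ _ from ⟨hlen, h⟩)]
      split_ifs
      exacts [le_rfl, zero_le]
  rw [this]
  exact tendsto_atTop_iSup hmono

end Subtree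

/-! ### Decomposition of the sample space at the root -/

section Decomposition

variable {d : ℕ}

/-- The sample with mark `m` at the root and with sample `η i` above the `i`-th child. -/
def graft (m : Mark d) (η : ℕ → Sample d) : Sample d := fun u =>
  match u.reverse with
  | [] => m
  | i :: v => η i v.reverse

@[simp] lemma graft_nil (m : Mark d) (η : ℕ → Sample d) : graft m η [] = m := rfl

@[simp] lemma graft_append (m : Mark d) (η : ℕ → Sample d) (v : Vertex) (i : ℕ) :
    graft m η (v ++ [i]) = η i v := by
  simp [graft]

lemma shift_graft (m : Mark d) (η : ℕ → Sample d) (i : ℕ) : shift i (graft m η) = η i := by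
  ext1 v
  simp [shift]

lemma measurable_graft :
    Measurable fun p : Mark d × (ℕ → Sample d) => graft p.1 p.2 := by
  refine measurable_pi_iff.mpr fun u => ?_
  rcases List.eq_nil_or_concat u with rfl | ⟨v, i, rfl⟩
  · simpa using measurable_fst
  · simp only [List.concat_eq_append, graft_append]
    exact (measurable_pi_apply v).comp ((measurable_pi_apply i).comp measurable_snd)

variable [NeZero d] (μ : PMF ℕ) (hμ : ∑' i : ℕ, (i : ℝ≥0∞) * μ i = 1)

instance : IsProbabilityMeasure (prob d μ hμ) := by
  unfold prob; infer_instance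

/-- The mark of the root and the samples above its potential children are independent, and each of
these samples is distributed as the original one. -/
lemma map_graft :
    ((markLaw d μ hμ).toMeasure.prod (Measure.infinitePi fun _ : ℕ => prob d μ hμ)).map
      (fun p => graft p.1 p.2) = prob d μ hμ := by
  classical
  refine Measure.eq_infinitePi _ fun s t ht => ?_
  let s' : Finset (ℕ × Vertex) :=
    s.preimage (fun p => p.2 ++ [p.1]) append_singleton_injective.injOn
  rw [Measure.map_apply measurable_graft (.pi s.countable_toSet fun i _ => ht i)]
  have hpre : (fun p : Mark d × (ℕ → Sample d) => graft p.1 p.2) ⁻¹' (s : Set Vertex).pi t =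
      (if [] ∈ s then t [] else Set.univ) ×ˢ
        {η | ∀ p ∈ s', η p.1 p.2 ∈ t (p.2 ++ [p.1])} := by
    ext ⟨m, η⟩
    simp only [Set.mem_preimage, Set.mem_pi, Finset.mem_coe, Set.mem_prod, Set.mem_ofPred_eq, s',
      Finset.mem_preimage]
    constructor
    · intro h
      refine ⟨?_, fun p hp => by simpa using h _ hp⟩
      split_ifs with h0
      · simpa using h _ h0
      · trivial
    · rintro ⟨h0, h⟩ u hu
      rcases List.eq_nil_or_concat u with rfl | ⟨v, i, rfl⟩
      · simpa [hu] using h0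
      · simp only [List.concat_eq_append] at hu ⊢
        simpa using h (i, v) hu
  rw [hpre, Measure.prod_prod]
  have h2 : (Measure.infinitePi fun _ : ℕ => prob d μ hμ)
      {η | ∀ p ∈ s', η p.1 p.2 ∈ t (p.2 ++ [p.1])} =
      ∏ p ∈ s', (markLaw d μ hμ).toMeasure (t (p.2 ++ [p.1])) := by
    have := Measure.infinitePi_map_curry_symm
      (fun (_ : ℕ) (_ : Vertex) => (markLaw d μ hμ).toMeasure)
    have hm := congrArg (fun ν => ν ((s' : Set (ℕ × Vertex)).pi fun p => t (p.2 ++ [p.1]))) this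
    beta_reduce at hm
    rw [Measure.infinitePi_pi _ (fun p _ => ht _), Measure.map_apply (by fun_prop)
      (.pi s'.countable_toSet fun p _ => ht _)] at hm
    rw [← hm]
    rfl
  have himage : s'.image (fun p => p.2 ++ [p.1]) = s.erase [] := by
    ext u
    rcases List.eq_nil_or_concat u with rfl | ⟨v, i, rfl⟩
    · simp
    · simp only [List.concat_eq_append, Finset.mem_image, Finset.mem_erase]
      constructor
      · rintro ⟨p, hp, hpu⟩
        exact ⟨by simp, hpu ▸ (Finset.mem_preimage (f := fun p : ℕ × Vertex => p.2 ++ [p.1])).mp hp⟩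
      · rintro ⟨-, hu⟩
        exact ⟨(i, v), Finset.mem_preimage.mpr hu, rfl⟩
  rw [h2, ← Finset.prod_image (s := s') (g := fun p : ℕ × Vertex => p.2 ++ [p.1])
    (f := fun u => (markLaw d μ hμ).toMeasure (t u)) append_singleton_injective.injOn, himage]
  by_cases h0 : [] ∈ s
  · rw [if_pos h0, Finset.mul_prod_erase s (fun u => (markLaw d μ hμ).toMeasure (t u)) h0]
  · rw [if_neg h0, measure_univ, one_mul, Finset.erase_eq_of_notMem h0]

/-- First-step analysis: integration over the mark of the root and over independent samples above
its children. -/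
lemma lintegral_prob (F : Mark d → (ℕ → Sample d) → ℝ≥0∞) (hF : ∀ m, Measurable (F m)) :
    ∫⁻ ω, F (ω []) (fun i => shift i ω) ∂prob d μ hμ =
      ∑' m, markLaw d μ hμ m * ∫⁻ η, F m η ∂Measure.infinitePi fun _ : ℕ => prob d μ hμ := by
  have hF' : Measurable fun p : Mark d × (ℕ → Sample d) => F p.1 p.2 :=
    measurable_from_prod_countable_right hF
  have hs : Measurable fun ω : Sample d => (fun i => shift i ω) :=
    measurable_pi_iff.mpr measurable_shift
  conv_lhs => rw [← map_graft]
  have hFs : Measurable fun ω : Sample d => F (ω []) (fun i => shift i ω) :=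
    hF'.comp ((measurable_pi_apply []).prodMk hs)
  rw [lintegral_map hFs measurable_graft]
  simp only [graft_nil, shift_graft]
  rw [lintegral_prod _ hF'.aemeasurable, lintegral_countable']
  refine tsum_congr fun m => ?_
  rw [PMF.toMeasure_apply_singleton _ _ (measurableSet_singleton m), mul_comm]

lemma lintegral_infinitePi_apply (g : Sample d → ℝ≥0∞) (hg : Measurable g) (i : ℕ) :
    ∫⁻ η, g (η i) ∂(Measure.infinitePi fun _ : ℕ => prob d μ hμ) = ∫⁻ ω, g ω ∂prob d μ hμ :=
  (measurePreserving_eval_infinitePi (fun _ : ℕ => prob d μ hμ) i).lintegral_comp hg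

lemma lintegral_infinitePi_prod (g : ℕ → Sample d → ℝ≥0∞) (hg : ∀ i, Measurable (g i))
    (s : Finset ℕ) :
    ∫⁻ η, ∏ i ∈ s, g i (η i) ∂(Measure.infinitePi fun _ : ℕ => prob d μ hμ) =
      ∏ i ∈ s, ∫⁻ ω, g i ω ∂prob d μ hμ := by
  refine (lintegral_prod_eq_prod_lintegral_of_indepFun s
    (fun (i : ℕ) (η : ℕ → Sample d) => g i (η i))
    (iIndepFun_infinitePi hg) (fun i => (hg i).comp (measurable_pi_apply i))).trans ?_
  exact Finset.prod_congr rfl fun i _ => lintegral_infinitePi_apply μ hμ (g i) (hg i) i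

end Decomposition

/-! ### Expectations with respect to the law of one mark -/

section MarkExpectation

lemma tsum_bind_mul {α β : Type*} (p : PMF α) (q : α → PMF β) (G : β → ℝ≥0∞) :
    ∑' b, (p.bind q) b * G b = ∑' a, p a * ∑' b, q a b * G b := by
  simp only [PMF.bind_apply, ← ENNReal.tsum_mul_right, ← ENNReal.tsum_mul_left]
  rw [ENNReal.tsum_comm]
  simp only [mul_assoc]

lemma tsum_map_mul {α β : Type*} (p : PMF α) (q : α → β) (G : β → ℝ≥0∞) :
    ∑' b, (p.map q) b * G b = ∑' a, p a * G (q a) := by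
  rw [PMF.map, tsum_bind_mul]
  refine tsum_congr fun a => ?_
  rw [tsum_eq_single (q a)] <;> simp +contextual

variable {d : ℕ} [NeZero d] (μ : PMF ℕ) (hμ : ∑' i : ℕ, (i : ℝ≥0∞) * μ i = 1)

lemma tsum_markLaw (F : Mark d → ℝ≥0∞) :
    ∑' m, markLaw d μ hμ m * F m =
      ∑' s, stepLaw d s * ∑' n, μ n * ∑' kj, spineLaw μ hμ kj * F ⟨n, kj.1, kj.2, s⟩ := by
  rw [markLaw, tsum_bind_mul]
  simp only [tsum_bind_mul, tsum_map_mul, ← ENNReal.tsum_mul_left]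
  conv_rhs => rw [ENNReal.tsum_comm]
  refine tsum_congr fun n => ?_
  conv_rhs => rw [ENNReal.tsum_comm]
  refine tsum_congr fun kj => tsum_congr fun s => ?_
  ring

lemma tsum_spineLaw (F : ℕ × ℕ → ℝ≥0∞) :
    ∑' kj, spineLaw μ hμ kj * F kj =
      ∑' k : ℕ, (k : ℝ≥0∞) * μ k * ∑' j, uniformBelow k j * F (k, j) := by
  rw [spineLaw, tsum_bind_mul]
  simp only [tsum_map_mul]
  rfl

lemma lt_of_uniformBelow_ne_zero {k j : ℕ} (hk : k ≠ 0) (h : uniformBelow k j ≠ 0) : j < k := by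
  obtain ⟨k, rfl⟩ := Nat.exists_eq_succ_of_ne_zero hk
  by_contra hj
  exact h (PMF.uniformOfFinset_apply_of_notMem ⟨0, by simp⟩ (by simpa using hj))

/-- The index of the special child is almost surely smaller than the number of children, so that
only such pairs contribute to an expectation under `spineLaw`. -/
lemma tsum_spineLaw_of_forall_lt (F : ℕ × ℕ → ℝ≥0∞) (c : ℕ → ℝ≥0∞)
    (h : ∀ k j, j < k → F (k, j) = c k) :
    ∑' kj, spineLaw μ hμ kj * F kj = ∑' k : ℕ, (k : ℝ≥0∞) * μ k * c k := by
  rw [tsum_spineLaw]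
  refine tsum_congr fun k => ?_
  rcases eq_or_ne k 0 with rfl | hk
  · simp
  · congr 1
    have : ∀ j, uniformBelow k j * F (k, j) = uniformBelow k j * c k := by
      intro j
      by_cases hj : uniformBelow k j = 0
      · simp [hj]
      · rw [h k j (lt_of_uniformBelow_ne_zero hk hj)]
    simp only [this, ENNReal.tsum_mul_right, PMF.tsum_coe, one_mul]

end MarkExpectation

/-! ### Exponential moments of truncated trees -/

section ExpMoment

variable {d : ℕ}

/-- The number of potential children of a vertex with a given mark and kind. -/
def arity (m : Mark d) : Kind → ℕ
  | .root => m.normalOffspring + 1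
  | .special => m.specialOffspring
  | .normal => m.normalOffspring

lemma treeRule_eq_none (m : Mark d) (b : Kind) {i : ℕ} (hi : arity m b ≤ i) :
    treeRule m b i = none := by
  cases b <;> exact if_neg (not_lt.mpr hi)

variable [NeZero d] (μ : PMF ℕ) (hμ : ∑' i : ℕ, (i : ℝ≥0∞) * μ i = 1) (f : Lattice d → ℝ≥0∞)

/-- The exponential moment of the sum of `f` over the first `n` generations of a subtree
above a vertex of kind `b` whose parent sits at `x`. -/
noncomputable def expMoment (n : ℕ∞) (b : Kind) (x : Lattice d) : ℝ≥0∞ :=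
  ∫⁻ ω, expENN (stepTreeSum treeRule f n b x ω) ∂prob d μ hμ

/-- First-step recursion for exponential moments. The starting point may depend on the mark of the
root, which covers both the tree and its subtrees. -/
lemma lintegral_expENN_treeSum_succ (n : ℕ∞) (b : Kind) (y : Mark d → Lattice d) :
    ∫⁻ ω, expENN (treeSum treeRule f (n + 1) b (y (ω [])) ω) ∂prob d μ hμ =
      ∑' m, markLaw d μ hμ m * (expENN (f (y m)) *
        ∏ i ∈ Finset.range (arity m b),
          (treeRule m b i).elim 1 fun c => expMoment μ hμ f n c (y m)) := by
  set g : Mark d → ℕ → Sample d → ℝ≥0∞ := fun m i ω =>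
    (treeRule m b i).elim 0 fun c => stepTreeSum treeRule f n c (y m) ω with hg
  have hgm : ∀ m i, Measurable (g m i) := by
    intro m i
    simp only [hg]
    rcases treeRule m b i with _ | c
    · exact measurable_const
    · exact measurable_stepTreeSum _ _ _ _ _
  have hsum : ∀ (m : Mark d) (η : ℕ → Sample d),
      expENN (f (y m) + ∑' i, g m i (η i)) =
        expENN (f (y m)) * ∏ i ∈ Finset.range (arity m b), expENN (g m i (η i)) := by
    intro m η
    rw [expENN_add, ← expENN_sum, tsum_eq_sum]
    intro i hi
    rw [Finset.mem_range, not_lt] at hi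
    simp [hg, treeRule_eq_none m b hi]
  have hexp : Measurable expENN := continuous_expENN.measurable
  have h1 : ∀ ω : Sample d, expENN (treeSum treeRule f (n + 1) b (y (ω [])) ω) =
      expENN (f (y (ω []))) * ∏ i ∈ Finset.range (arity (ω []) b),
        expENN (g (ω []) i (shift i ω)) := fun ω => by
    rw [treeSum_succ, ← hsum]
  simp only [h1]
  have hprod : ∀ m : Mark d, Measurable fun η : ℕ → Sample d =>
      ∏ i ∈ Finset.range (arity m b), expENN (g m i (η i)) := fun m =>
    Finset.measurable_fun_prod _ fun i _ => hexp.comp ((hgm m i).comp (measurable_pi_apply i))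
  rw [lintegral_prob μ hμ (fun m η => expENN (f (y m)) *
    ∏ i ∈ Finset.range (arity m b), expENN (g m i (η i))) fun m => (hprod m).const_mul _]
  refine tsum_congr fun m => ?_
  rw [lintegral_const_mul _ (hprod m),
    lintegral_infinitePi_prod μ hμ (fun i ω => expENN (g m i ω)) (fun i => hexp.comp (hgm m i))]
  congr 2
  refine Finset.prod_congr rfl fun i _ => ?_
  simp only [hg]
  rcases treeRule m b i with _ | c
  · simp
  · rfl

lemma expMoment_succ (n : ℕ∞) (b : Kind) (x : Lattice d) :
    expMoment μ hμ f (n + 1) b x =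
      ∑' m, markLaw d μ hμ m * (expENN (f (x + m.step)) *
        ∏ i ∈ Finset.range (arity m b),
          (treeRule m b i).elim 1 fun c => expMoment μ hμ f n c (x + m.step)) :=
  lintegral_expENN_treeSum_succ μ hμ f n b fun m => x + m.step

lemma expMoment_zero (b : Kind) (x : Lattice d) : expMoment μ hμ f 0 b x = 1 := by
  simp [expMoment, stepTreeSum, treeSum_zero]

lemma transition_one_add (H : Lattice d → ℝ≥0∞) (x : Lattice d) :
    transition (fun y => 1 + H y) x = 1 + transition H x := by
  have : (fun y => 1 + H y) = (fun _ => (1 : ℝ≥0∞)) + H := rfl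
  rw [this, transition_add, transition_const]
  rfl

variable {μ hμ f}

/-- A supersolution of the recursion for normal vertices dominates the exponential moments of all
truncated normal subtrees. -/
lemma expMoment_normal_le {H : Lattice d → ℝ≥0∞}
    (hH : ∀ x, expENN (f x) * ∑' m : ℕ, μ m * (1 + transition H x) ^ m ≤ 1 + H x)
    (n : ℕ) (x : Lattice d) : expMoment μ hμ f n .normal x ≤ 1 + transition H x := by
  induction n generalizing x with
  | zero => simp [expMoment_zero]
  | succ n ih =>
    have hprod : ∀ (m : Mark d) (y : Lattice d), ∏ i ∈ Finset.range (arity m .normal),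
        (treeRule m .normal i).elim 1 (fun c => expMoment μ hμ f n c y) ≤
          (1 + transition H y) ^ m.normalOffspring := by
      intro m y
      calc _ ≤ ∏ i ∈ Finset.range m.normalOffspring, (1 + transition H y) := by
            refine Finset.prod_le_prod' fun i hi => ?_
            rw [arity, Finset.mem_range] at hi
            simpa [treeRule, hi] using ih y
        _ = _ := by simp
    rw [Nat.cast_succ, expMoment_succ, ← transition_one_add]
    calc _ ≤ ∑' m, markLaw d μ hμ m * (expENN (f (x + m.step)) *
          (1 + transition H (x + m.step)) ^ m.normalOffspring) := by
          gcongr with m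
          exact hprod m _
      _ = ∑' s, stepLaw d s * (expENN (f (x + s)) *
            ∑' n, μ n * (1 + transition H (x + s)) ^ n) := by
          rw [tsum_markLaw]
          refine tsum_congr fun s => ?_
          congr 1
          simp only [ENNReal.tsum_mul_right, PMF.tsum_coe, one_mul]
          rw [← ENNReal.tsum_mul_left]
          exact tsum_congr fun n => by ring
      _ ≤ _ := by
          refine ENNReal.tsum_le_tsum fun s => ?_
          gcongr
          exact hH _

/-- A supersolution of the recursion for special vertices dominates the exponential moments of all
truncated special subtrees. -/
lemma expMoment_special_le {H W : Lattice d → ℝ≥0∞}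
    (hH : ∀ x, expENN (f x) * ∑' m : ℕ, μ m * (1 + transition H x) ^ m ≤ 1 + H x)
    (hW : ∀ x, expENN (f x) * (∑' k : ℕ, (k : ℝ≥0∞) * μ k * (1 + transition H x) ^ (k - 1)) *
      (1 + transition W x) ≤ 1 + W x)
    (n : ℕ) (x : Lattice d) : expMoment μ hμ f n .special x ≤ 1 + transition W x := by
  induction n generalizing x with
  | zero => simp [expMoment_zero]
  | succ n ih =>
    rw [Nat.cast_succ, expMoment_succ, ← transition_one_add]
    set G : Lattice d → ℕ × ℕ → ℝ≥0∞ := fun y kj => ∏ i ∈ Finset.range kj.1,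
      if i = kj.2 then 1 + transition W y else 1 + transition H y with hG
    have hprod : ∀ (m : Mark d) (y : Lattice d), ∏ i ∈ Finset.range (arity m .special),
        (treeRule m .special i).elim 1 (fun c => expMoment μ hμ f n c y) ≤
          G y (m.specialOffspring, m.specialChild) := by
      intro m y
      refine Finset.prod_le_prod' fun i hi => ?_
      rw [arity, Finset.mem_range] at hi
      by_cases hij : i = m.specialChild
      · simpa [treeRule, hij ▸ hi, hij] using ih y
      · simpa [treeRule, hi, hij] using expMoment_normal_le hH n y
    have hGeq : ∀ y k j, j < k →
        G y (k, j) = (1 + transition H y) ^ (k - 1) * (1 + transition W y) := by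
      intro y k j hjk
      simp only [hG]
      rw [← Finset.prod_erase_mul _ _ (Finset.mem_range.mpr hjk), if_pos rfl]
      congr 1
      rw [Finset.prod_congr rfl fun i hi => if_neg (Finset.ne_of_mem_erase hi),
        Finset.prod_const, Finset.card_erase_of_mem (Finset.mem_range.mpr hjk), Finset.card_range]
    calc _ ≤ ∑' m, markLaw d μ hμ m * (expENN (f (x + m.step)) *
          G (x + m.step) (m.specialOffspring, m.specialChild)) := by
          gcongr with m
          exact hprod m _
      _ = ∑' s, stepLaw d s * (expENN (f (x + s)) *
            (∑' k : ℕ, (k : ℝ≥0∞) * μ k * (1 + transition H (x + s)) ^ (k - 1)) *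
              (1 + transition W (x + s))) := by
          rw [tsum_markLaw]
          refine tsum_congr fun s => ?_
          congr 1
          have h2 : ∀ kj : ℕ × ℕ, spineLaw μ hμ kj * (expENN (f (x + s)) * G (x + s) kj) =
              expENN (f (x + s)) * (spineLaw μ hμ kj * G (x + s) kj) := fun kj => by ring
          simp only [ENNReal.tsum_mul_right, PMF.tsum_coe, one_mul, Prod.mk.eta, h2,
            ENNReal.tsum_mul_left]
          rw [tsum_spineLaw_of_forall_lt μ hμ _ _ (hGeq (x + s)), mul_assoc,
            ← ENNReal.tsum_mul_right]
          simp only [mul_assoc]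
      _ ≤ _ := by
          refine ENNReal.tsum_le_tsum fun s => ?_
          gcongr
          exact hW _

/-- Bound on the exponential moment of the sum over the infinite tree, by monotone convergence from
its truncations. -/
lemma lintegral_expENN_treeSum_root_le {H W : Lattice d → ℝ≥0∞}
    (hH : ∀ x, expENN (f x) * ∑' m : ℕ, μ m * (1 + transition H x) ^ m ≤ 1 + H x)
    (hW : ∀ x, expENN (f x) * (∑' k : ℕ, (k : ℝ≥0∞) * μ k * (1 + transition H x) ^ (k - 1)) *
      (1 + transition W x) ≤ 1 + W x) (x : Lattice d) :
    ∫⁻ ω, expENN (treeSum treeRule f ⊤ .root x ω) ∂prob d μ hμ ≤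
      (1 + H x) * (1 + transition W x) := by
  have hfin : ∀ n : ℕ, ∫⁻ ω, expENN (treeSum treeRule f ((n + 1 : ℕ) : ℕ∞) .root x ω)
      ∂prob d μ hμ ≤ (1 + H x) * (1 + transition W x) := by
    intro n
    rw [Nat.cast_succ]
    rw [lintegral_expENN_treeSum_succ μ hμ f n .root fun _ => x]
    have hprod : ∀ m : Mark d, ∏ i ∈ Finset.range (arity m .root),
        (treeRule m .root i).elim 1 (fun c => expMoment μ hμ f n c x) ≤
          (1 + transition H x) ^ m.normalOffspring * (1 + transition W x) := by
      intro m
      rw [arity, Finset.prod_range_succ']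
      refine mul_le_mul' ?_ ?_
      · calc _ ≤ ∏ i ∈ Finset.range m.normalOffspring, (1 + transition H x) := by
              refine Finset.prod_le_prod' fun i hi => ?_
              rw [Finset.mem_range] at hi
              simpa [treeRule, hi] using expMoment_normal_le hH n x
          _ = _ := by simp
      · simpa [treeRule] using expMoment_special_le hH hW n x
    calc _ ≤ ∑' m, markLaw d μ hμ m * (expENN (f x) *
          ((1 + transition H x) ^ m.normalOffspring * (1 + transition W x))) := by
          gcongr with m
          exact hprod m
      _ = expENN (f x) * (∑' n, μ n * (1 + transition H x) ^ n) * (1 + transition W x) := by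
          rw [tsum_markLaw]
          simp only [ENNReal.tsum_mul_right, PMF.tsum_coe, one_mul]
          rw [← ENNReal.tsum_mul_left, ← ENNReal.tsum_mul_right]
          exact tsum_congr fun n => by ring
      _ ≤ _ := by gcongr; exact hH x
  have hlim := lintegral_tendsto_of_tendsto_of_monotone (μ := prob d μ hμ)
    (f := fun (n : ℕ) ω => expENN (treeSum treeRule f ((n + 1 : ℕ) : ℕ∞) .root x ω))
    (F := fun ω => expENN (treeSum treeRule f ⊤ .root x ω))
    (fun n => (continuous_expENN.measurable.comp (measurable_treeSum _ _ _ _ _)).aemeasurable)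
    (Filter.Eventually.of_forall fun ω n m hnm => expENN_mono
      (treeSum_mono _ _ (by exact_mod_cast Nat.succ_le_succ hnm) _ _ _))
    (Filter.Eventually.of_forall fun ω => (continuous_expENN.tendsto _).comp
      ((tendsto_treeSum treeRule f .root x ω).comp (Filter.tendsto_add_atTop_nat 1)))
  exact le_of_tendsto' hlim hfin

end ExpMoment

/-! ### The trees of the model as grown trees -/

section Identification

variable {d : ℕ} (ω : Sample d)

open Classical in
lemma kind_treeRule (u : Vertex) : kind treeRule ω .root u =
    if InTree ω u then
      some (if u = [] then .root else if IsSpecial ω u then .special else .normal)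
    else none := by
  induction u with
  | nil => simp [kind, InTree]
  | cons i u ih =>
    have hmem : ∀ i u, InTree ω (i :: u) ↔ InTree ω u ∧ i < offspring ω u := fun _ _ => Iff.rfl
    rw [kind, ih]
    rcases u with _ | ⟨j, w⟩
    · by_cases h : i ≤ (ω []).normalOffspring <;> by_cases h0 : i = 0 <;>
        simp [treeRule, InTree, offspring, IsSpecial, specialIndex, h, h0]
    · have hSi : IsSpecial ω (i :: j :: w) ↔ IsSpecial ω (j :: w) ∧
        i = (ω (j :: w)).specialChild := Iff.rfl
      have hoff : offspring ω (j :: w) = if IsSpecial ω (j :: w) then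
        (ω (j :: w)).specialOffspring else (ω (j :: w)).normalOffspring := rfl
      rw [hmem i (j :: w), hSi, hoff]
      generalize InTree ω (j :: w) = T
      generalize IsSpecial ω (j :: w) = S
      by_cases hT : T
      · by_cases hS : S
        · by_cases h : i < (ω (j :: w)).specialOffspring <;>
            by_cases h0 : i = (ω (j :: w)).specialChild <;>
          simp [treeRule, hT, hS, h, h0]
        · by_cases h : i < (ω (j :: w)).normalOffspring <;>
          simp [treeRule, hT, hS, h]
      · simp [hT]

open Classical in
lemma kind_pastRule (u : Vertex) : kind pastRule ω .root u =
    if u = [] then some .root else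
      if u ∈ past ω then some (if IsSpecial ω u then .special else .normal) else none := by
  induction u with
  | nil => simp [kind]
  | cons i u ih =>
    have hmem : ∀ i u, i :: u ∈ past ω ↔ (InTree ω u ∧ i < offspring ω u) ∧
      (IsSpecial ω (i :: u) ∨ (IsSpecial ω u ∧ i < specialIndex ω u) ∨
        (¬ IsSpecial ω u ∧ IsPast ω u)) := fun _ _ => Iff.rfl
    rw [kind, ih]
    rcases u with _ | ⟨j, w⟩
    · by_cases h0 : i = 0 <;>
        simp [pastRule, hmem, InTree, offspring, IsSpecial, specialIndex, h0]
    · have hmem' : j :: w ∈ past ω ↔ InTree ω (j :: w) ∧ IsPast ω (j :: w) := Iff.rfl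
      have hsp : IsSpecial ω (j :: w) → IsPast ω (j :: w) := fun h => Or.inl h
      have hSi : IsSpecial ω (i :: j :: w) ↔ IsSpecial ω (j :: w) ∧
        i = (ω (j :: w)).specialChild := Iff.rfl
      have hidx : specialIndex ω (j :: w) = (ω (j :: w)).specialChild := rfl
      have hoff : offspring ω (j :: w) = if IsSpecial ω (j :: w) then
        (ω (j :: w)).specialOffspring else (ω (j :: w)).normalOffspring := rfl
      rw [hmem i (j :: w), hSi, hidx, hmem', hoff]
      generalize InTree ω (j :: w) = T
      generalize IsPast ω (j :: w) = P at *
      generalize IsSpecial ω (j :: w) = S at *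
      by_cases hT : T
      · by_cases hS : S
        · have hP := hsp hS
          generalize hc : (ω (j :: w)).specialChild = c
          rcases lt_trichotomy i c with h0 | h0 | h0
          · by_cases h : i < (ω (j :: w)).specialOffspring <;>
              simp [pastRule, hT, hS, hP, hc, h, h0, h0.ne]
          · subst h0
            by_cases h : i < (ω (j :: w)).specialOffspring <;>
              simp [pastRule, hT, hS, hP, hc, h]
          · by_cases h : i < (ω (j :: w)).specialOffspring <;>
              simp [pastRule, hT, hS, hP, hc, h, h0.ne', h0.not_gt]
        · by_cases hP : P <;>
            by_cases h : i < (ω (j :: w)).normalOffspring <;>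
          simp [pastRule, hT, hS, hP, h]
      · simp [hT]

lemma totalPotential_eq_treeSum (φ : Lattice d → ℝ≥0) :
    totalPotential φ ω = treeSum treeRule (fun x => (φ x : ℝ≥0∞)) ⊤ .root 0 ω := by
  classical
  rw [totalPotential, tsum_subtype (tree ω) (fun u => (φ (walk ω 0 u) : ℝ≥0∞)), treeSum]
  refine tsum_congr fun u => ?_
  by_cases h : InTree ω u <;> simp [Set.indicator, tree, kind_treeRule, h]

/-- The past is the part of the tree grown by `pastRule` that sits above the special child of the
root. -/
lemma tsum_past_eq_stepTreeSum (f : Lattice d → ℝ≥0∞) (x : Lattice d) (hf : f x ≠ ∞) :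
    ∑' u : past ω, f (walk ω x u) = stepTreeSum pastRule f ⊤ .special x (shift 0 ω) := by
  classical
  have h1 := treeSum_succ pastRule f ⊤ .root x ω
  rw [tsum_eq_single 0 (by intro i hi; simp [pastRule, hi])] at h1
  have h2 : treeSum pastRule f ⊤ .root x ω = f x + ∑' u : past ω, f (walk ω x u) := by
    rw [tsum_subtype (past ω) (fun u => f (walk ω x u)), treeSum,
      ENNReal.tsum_eq_add_tsum_ite []]
    have h0 : ((([] : Vertex).length : ℕ) : ℕ∞) < ⊤ ∧ kind pastRule ω .root [] ≠ none := by
      simp [kind]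
    rw [if_pos h0]
    congr 1
    refine tsum_congr fun u => ?_
    by_cases hu : u = []
    · subst hu
      simp [Set.indicator, past, IsPast]
    · by_cases h : u ∈ past ω <;> simp [Set.indicator, kind_pastRule, h, hu]
  have h3 : f x + ∑' u : past ω, f (walk ω x u) =
      f x + stepTreeSum pastRule f ⊤ .special x (shift 0 ω) := by
    rw [← h2]
    simpa [pastRule] using h1
  exact (ENNReal.add_right_inj hf).mp h3

end Identification

/-! ### First moments and the Green's function of the past -/

section FirstMoment

variable {d : ℕ} [NeZero d] (μ : PMF ℕ) (hμ : ∑' i : ℕ, (i : ℝ≥0∞) * μ i = 1)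

/-- The expectation of the sum of `f` over the part of the past above a vertex of kind `b`, that
vertex included, when its parent sits at `x`. -/
noncomputable def pastMoment (f : Lattice d → ℝ≥0∞) (b : Kind) (x : Lattice d) : ℝ≥0∞ :=
  ∫⁻ ω, stepTreeSum pastRule f ⊤ b x ω ∂prob d μ hμ

/-- First-step recursion for first moments. -/
lemma pastMoment_eq (f : Lattice d → ℝ≥0∞) (b : Kind) (x : Lattice d) :
    pastMoment μ hμ f b x = ∑' m, markLaw d μ hμ m * (f (x + m.step) +
      ∑' i, (pastRule m b i).elim 0 fun c => pastMoment μ hμ f c (x + m.step)) := by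
  set g : Mark d → ℕ → Sample d → ℝ≥0∞ := fun m i ω =>
    (pastRule m b i).elim 0 fun c => stepTreeSum pastRule f ⊤ c (x + m.step) ω with hg
  have hgm : ∀ m i, Measurable (g m i) := by
    intro m i
    simp only [hg]
    rcases pastRule m b i with _ | c
    · exact measurable_const
    · exact measurable_stepTreeSum _ _ _ _ _
  have hgm' : ∀ m i, Measurable fun η : ℕ → Sample d => g m i (η i) := fun m i =>
    (hgm m i).comp (measurable_pi_apply i)
  have h1 : ∀ ω : Sample d, stepTreeSum pastRule f ⊤ b x ω =
      f (x + (ω []).step) + ∑' i, g (ω []) i (shift i ω) := fun ω =>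
    treeSum_succ pastRule f ⊤ b (x + (ω []).step) ω
  simp only [pastMoment, h1]
  rw [lintegral_prob μ hμ (fun m η => f (x + m.step) + ∑' i, g m i (η i))
    fun m => measurable_const.add (Measurable.tsum (hgm' m))]
  refine tsum_congr fun m => ?_
  rw [lintegral_add_left measurable_const, lintegral_const, measure_univ, mul_one,
    lintegral_tsum fun i => (hgm' m i).aemeasurable]
  congr 2
  refine tsum_congr fun i => ?_
  rw [lintegral_infinitePi_apply μ hμ (g m i) (hgm m i) i]
  simp only [hg]
  rcases pastRule m b i with _ | c
  · simp
  · rfl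

/-- The normal subtrees are critical, so their first moments solve the same equation as the Green's
operator of simple random walk. -/
lemma pastMoment_normal (f : Lattice d → ℝ≥0∞) (x : Lattice d) :
    pastMoment μ hμ f .normal x =
      transition f x + transition (pastMoment μ hμ f .normal) x := by
  have hsum : ∀ (m : Mark d) (y : Lattice d),
      ∑' i, (pastRule m .normal i).elim 0 (fun c => pastMoment μ hμ f c y) =
        m.normalOffspring * pastMoment μ hμ f .normal y := by
    intro m y
    rw [tsum_eq_sum (s := Finset.range m.normalOffspring)
      (by intro i hi; simp [pastRule, Finset.mem_range.not.mp hi])]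
    rw [Finset.sum_congr rfl fun i hi => by
      rw [show pastRule m .normal i = some .normal from if_pos (Finset.mem_range.mp hi)]]
    simp
  rw [pastMoment_eq, tsum_markLaw]
  simp only [hsum, transition, ← ENNReal.tsum_add, ENNReal.tsum_mul_right, PMF.tsum_coe, one_mul]
  refine tsum_congr fun s => ?_
  simp only [mul_add, ENNReal.tsum_add, ENNReal.tsum_mul_right, PMF.tsum_coe, one_mul]
  congr 2
  calc ∑' n : ℕ, μ n * (n * pastMoment μ hμ f .normal (x + s))
      = (∑' n : ℕ, (n : ℝ≥0∞) * μ n) * pastMoment μ hμ f .normal (x + s) := by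
        rw [← ENNReal.tsum_mul_right]
        exact tsum_congr fun n => by ring
    _ = _ := by rw [hμ, one_mul]

lemma lt_of_spineLaw_ne_zero {kj : ℕ × ℕ} (h : spineLaw μ hμ kj ≠ 0) : kj.2 < kj.1 := by
  rw [← PMF.mem_support_iff, spineLaw, PMF.mem_support_bind_iff] at h
  obtain ⟨k, hk, h⟩ := h
  obtain ⟨j, hj, rfl⟩ := (PMF.mem_support_map_iff _ _ _).mp h
  refine lt_of_uniformBelow_ne_zero ?_ hj
  rintro rfl
  exact (PMF.mem_support_iff _ _).mp hk
    (show ((0 : ℕ) : ℝ≥0∞) * μ 0 = 0 by simp)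

/-- The probability that a special vertex has a normal child before its special child. -/
noncomputable def branchProb : ℝ≥0∞ :=
  ∑' kj : ℕ × ℕ, spineLaw μ hμ kj * if 0 < kj.2 then 1 else 0

/-- The spine contributes `f` at every special vertex and, with probability `branchProb`, at least
one normal subtree in the past. -/
lemma transition_add_le_pastMoment_special (f : Lattice d → ℝ≥0∞) (x : Lattice d) :
    transition (fun y => f y + branchProb μ hμ * pastMoment μ hμ f .normal y) x +
      transition (pastMoment μ hμ f .special) x ≤ pastMoment μ hμ f .special x := by
  set N := pastMoment μ hμ f .normal with hN
  set S := pastMoment μ hμ f .special with hS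
  have hlow : ∀ (m : Mark d) (y : Lattice d), m.specialChild < m.specialOffspring →
      S y + (if 0 < m.specialChild then 1 else 0) * N y ≤
        ∑' i, (pastRule m .special i).elim 0 (fun c => pastMoment μ hμ f c y) := by
    intro m y hm
    by_cases h0 : 0 < m.specialChild
    · refine le_trans (le_of_eq ?_) (ENNReal.sum_le_tsum {m.specialChild, 0})
      rw [Finset.sum_pair h0.ne']
      simp [pastRule, hm, h0, h0.ne, h0.trans hm, hN, hS]
    · refine le_trans (le_of_eq ?_) (ENNReal.le_tsum m.specialChild)
      simp [pastRule, hm, h0, hS]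
  rw [hS, pastMoment_eq, tsum_markLaw, ← hS]
  simp only [transition, ← ENNReal.tsum_add, ← mul_add]
  refine ENNReal.tsum_le_tsum fun s => ?_
  gcongr
  calc f (x + s) + branchProb μ hμ * N (x + s) + S (x + s)
      = ∑' n, μ n * ∑' kj : ℕ × ℕ, spineLaw μ hμ kj *
          (f (x + s) + (S (x + s) + (if 0 < kj.2 then 1 else 0) * N (x + s))) := by
        have h3 : ∀ kj : ℕ × ℕ, spineLaw μ hμ kj * ((if 0 < kj.2 then 1 else 0) * N (x + s)) =
          (spineLaw μ hμ kj * if 0 < kj.2 then 1 else 0) * N (x + s) := fun kj => by ring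
        simp only [mul_add, ENNReal.tsum_add, ENNReal.tsum_mul_right, PMF.tsum_coe, one_mul, h3]
        rw [branchProb]
        ring
    _ ≤ _ := by
        refine ENNReal.tsum_le_tsum fun n => mul_le_mul' le_rfl
          (ENNReal.tsum_le_tsum fun kj => ?_)
        by_cases hkj : spineLaw μ hμ kj = 0
        · simp [hkj]
        · gcongr
          exact hlow ⟨n, kj.1, kj.2, s⟩ (x + s) (lt_of_spineLaw_ne_zero μ hμ hkj)

/-- The Green's function of the past integrates functions to their first moments. -/
lemma tsum_green_mul (φ : Lattice d → ℝ≥0) (x : Lattice d) :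
    ∑' y, green d μ hμ x y * (φ y : ℝ≥0∞) =
      pastMoment μ hμ (fun y => (φ y : ℝ≥0∞)) .special x := by
  classical
  have hg : ∀ y, green d μ hμ x y =
      pastMoment μ hμ (fun z => if z = y then 1 else 0) .special x := by
    intro y
    rw [green, pastMoment]
    have h1 : ∀ ω : Sample d, ∑' u : past ω, (if walk ω x u = y then (1 : ℝ≥0∞) else 0) =
        stepTreeSum pastRule (fun z => if z = y then 1 else 0) ⊤ .special x (shift 0 ω) := by
      intro ω
      rw [← tsum_past_eq_stepTreeSum _ _ _ (by split_ifs <;> simp)]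
    simp only [h1]
    have hm := measurable_stepTreeSum pastRule (fun z : Lattice d => if z = y then 1 else 0) ⊤
      .special x
    rw [lintegral_prob μ hμ (fun _ η => stepTreeSum pastRule (fun z => if z = y then 1 else 0) ⊤
      .special x (η 0)) fun _ => hm.comp (measurable_pi_apply 0)]
    rw [lintegral_infinitePi_apply μ hμ _ hm 0, ENNReal.tsum_mul_right, PMF.tsum_coe, one_mul]
  have hlin : ∀ ω : Sample d, stepTreeSum pastRule (fun y => (φ y : ℝ≥0∞)) ⊤ .special x ω =
      ∑' y, stepTreeSum pastRule (fun z => if z = y then 1 else 0) ⊤ .special x ω * φ y := by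
    intro ω
    simp only [stepTreeSum, treeSum, ← ENNReal.tsum_mul_right]
    rw [ENNReal.tsum_comm]
    refine tsum_congr fun u => ?_
    split_ifs
    · rw [tsum_eq_single (walk ω (x + (ω []).step) u)]
      · simp
      · intro y hy
        simp [hy.symm]
    · simp
  simp only [hg, pastMoment, hlin]
  rw [lintegral_tsum fun y => ((measurable_stepTreeSum _ _ _ _ _).mul_const _).aemeasurable]
  refine tsum_congr fun y => ?_
  rw [lintegral_mul_const _ (measurable_stepTreeSum _ _ _ _ _)]

/-- If a special vertex almost surely has no child before the special one, then `μ` is carried by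
`{0, 1}`, and having mean one it is the Dirac mass at `1`. -/
lemma branchProb_ne_zero
    (hvar : 0 < evariance (fun i : ℕ => (i : ℝ)) μ.toMeasure) : branchProb μ hμ ≠ 0 := by
  intro h0
  have hμ2 : ∀ k : ℕ, 2 ≤ k → μ k = 0 := by
    intro k hk
    by_contra hne
    rw [branchProb, ENNReal.tsum_eq_zero] at h0
    have h1 : spineLaw μ hμ (k, 1) = 0 := by simpa using h0 (k, 1)
    refine (PMF.mem_support_iff (spineLaw μ hμ) (k, 1)).mp ?_ h1
    rw [spineLaw, PMF.mem_support_bind_iff]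
    refine ⟨k, ?_, (PMF.mem_support_map_iff _ _ _).mpr ⟨1, ?_, rfl⟩⟩
    · rw [PMF.mem_support_iff]
      exact mul_ne_zero (by simp; omega) hne
    · obtain ⟨k, rfl⟩ := Nat.exists_eq_succ_of_ne_zero (by omega : k ≠ 0)
      exact (PMF.mem_support_uniformOfFinset_iff ⟨0, by simp⟩ 1).mpr
        (Finset.mem_range.mpr (by omega))
  have h1 : μ 1 = 1 := by
    rw [← hμ, tsum_eq_single 1]
    · simp
    · intro k hk
      rcases Nat.lt_or_ge k 2 with h | h
      · have : k = 0 := by omega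
        simp [this]
      · simp [hμ2 k h]
  have hsupp : μ = PMF.pure 1 := by
    have := (PMF.apply_eq_one_iff μ 1).mp h1
    ext k
    by_cases hk : k = 1
    · simp [hk, h1]
    · have hk' : k ∉ μ.support := by rw [this]; simpa using hk
      simp [hk, (PMF.apply_eq_zero_iff μ k).mpr hk']
  refine hvar.ne' ?_
  rw [hsupp, PMF.toMeasure_pure]
  refine (evariance_eq_zero_iff (measurable_of_countable _).aemeasurable).mpr ?_
  simp [Filter.EventuallyEq, ae_dirac_eq]

/-- Smallness of `‖Gφ‖_∞` implies smallness of the iterated potential of simple random walk. With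
`P` the transition operator and `g` the potential operator, the first moment of a normal subtree is
at least `P g f`, so `‖Gφ‖_∞` bounds `P g (f + c P g f)`, where `c` is `branchProb`. The remaining
terms of `g g f` are multiples of `P g f` and of `f`, which is at most `2 d` times its average over
neighbours. -/
lemma potential_potential_le {f : Lattice d → ℝ≥0∞} {κ : ℝ≥0∞} (h0 : branchProb μ hμ ≠ 0)
    (hκ : ∀ x, pastMoment μ hμ f .special x ≤ κ) (x : Lattice d) :
    potential (potential f) x ≤ (2 * d + 2 + (branchProb μ hμ)⁻¹) * κ := by
  set c := branchProb μ hμ with hc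
  have hc1 : c ≠ ∞ := by
    refine ne_top_of_le_ne_top ENNReal.one_ne_top ?_
    rw [hc, branchProb, ← (spineLaw μ hμ).tsum_coe]
    refine ENNReal.tsum_le_tsum fun kj => ?_
    split_ifs <;> simp
  set N := pastMoment μ hμ f .normal with hN
  have hNlow : ∀ x, transition (potential f) x ≤ N x := by
    rw [← potential_transition]
    exact potential_le_of_supersolution fun x => (pastMoment_normal μ hμ f x).ge
  have hS : ∀ x, transition (potential fun y => f y + c * N y) x ≤ κ := by
    intro x
    refine le_trans ?_ (hκ x)
    rw [← potential_transition]
    exact potential_le_of_supersolution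
      (fun x => transition_add_le_pastMoment_special μ hμ f x) x
  have h1 : ∀ x, transition (potential f) x ≤ κ := fun x =>
    (transition_mono (potential_mono fun y => le_self_add) x).trans (hS x)
  have h2 : ∀ x, transition (potential (transition (potential f))) x ≤ c⁻¹ * κ := by
    intro x
    rw [mul_comm, ← div_eq_mul_inv, ENNReal.le_div_iff_mul_le (Or.inl h0) (Or.inl hc1), mul_comm]
    refine le_trans ?_ (hS x)
    have : c * transition (potential (transition (potential f))) x =
        transition (potential fun y => c * transition (potential f) y) x := by
      rw [potential_const_mul, transition_const_mul]
    rw [this]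
    refine transition_mono (potential_mono fun y => ?_) x
    exact le_add_left (by gcongr; exact hNlow y)
  have h3 : ∀ x, f x ≤ 2 * d * κ := by
    intro x
    have i₀ : Fin d := ⟨0, NeZero.pos d⟩
    have := le_transition_of_neighbour f (x - Pi.single i₀ ((1 : ℤˣ) : ℤ)) (i₀, 1)
    rw [sub_add_cancel] at this
    refine this.trans ?_
    gcongr
    exact (transition_mono (le_potential f) _).trans (h1 _)
  have hgf : potential f = f + transition (potential f) := funext (potential_eq_add_transition f)
  calc potential (potential f) x
      = potential f x + potential (transition (potential f)) x := by
        conv_lhs => rw [hgf]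
        rw [potential_add, Pi.add_apply]
    _ = (f x + transition (potential f) x) + (transition (potential f) x +
          transition (potential (transition (potential f))) x) := by
        rw [← potential_eq_add_transition f x,
          ← potential_eq_add_transition (transition (potential f)) x]
    _ ≤ (2 * d * κ + κ) + (κ + c⁻¹ * κ) := by
        gcongr
        exacts [h3 x, h1 x, h1 x, h2 x]
    _ = _ := by ring

end FirstMoment

end BRW

open BRW in
theorem mainTheorem2 (d : ℕ) [NeZero d] (hd : 5 ≤ d) (μ : PMF ℕ)
    (hmean : ∑' i : ℕ, (i : ℝ≥0∞) * μ i = 1)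
    (hvar_pos : 0 < evariance (fun i : ℕ => (i : ℝ)) μ.toMeasure)
    (hvar_fin : evariance (fun i : ℕ => (i : ℝ)) μ.toMeasure < ⊤)
    (hexp : ∃ l : ℝ, 0 < l ∧ ∑' i : ℕ, ENNReal.ofReal (Real.exp (l * i)) * μ i < ⊤) :
    ∃ κ : ℝ, 0 < κ ∧ ∀ φ : BRW.Lattice d → ℝ≥0,
      BRW.greenNorm d μ hmean φ ≤ ENNReal.ofReal κ →
        ∫⁻ ω, EReal.exp ((BRW.totalPotential φ ω : ℝ≥0∞) : EReal) ∂(BRW.prob d μ hmean) ≤ 2 := by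
  obtain ⟨ε, hε, hsuper⟩ :=
    exists_supersolutions (d := d) ((by norm_num : 3 ≤ 5).trans hd) μ hmean hexp
  have hc := branchProb_ne_zero μ hmean hvar_pos
  set K : ℝ≥0 := 2 * d + 2 + (branchProb μ hmean)⁻¹.toNNReal with hK
  have hK0 : 0 < K := by positivity
  have hKc : (K : ℝ≥0∞) = 2 * d + 2 + (branchProb μ hmean)⁻¹ := by
    rw [hK]
    push_cast
    rw [ENNReal.coe_toNNReal (ENNReal.inv_ne_top.mpr hc)]
  refine ⟨(ε / K : ℝ≥0), by positivity, fun φ hφ => ?_⟩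
  rw [ENNReal.ofReal_coe_nnreal] at hφ
  set f : Lattice d → ℝ≥0∞ := fun y => (φ y : ℝ≥0∞) with hf
  have hpot : ∀ x, potential (potential f) x ≤ ε := by
    intro x
    refine (potential_potential_le μ hmean (κ := (ε / K : ℝ≥0)) hc (fun x => ?_) x).trans ?_
    · rw [← tsum_green_mul]
      exact (le_iSup (fun x => ∑' y, green d μ hmean x y * (φ y : ℝ≥0∞)) x).trans hφ
    · rw [← hKc, ← ENNReal.coe_mul, mul_div_cancel₀ _ hK0.ne']
  obtain ⟨H, W, hH4, hW4, hPW, hH, hW⟩ := hsuper f hpot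
  have h := lintegral_expENN_treeSum_root_le (hμ := hmean) hH hW 0
  calc ∫⁻ ω, EReal.exp ((totalPotential φ ω : ℝ≥0∞) : EReal) ∂(prob d μ hmean)
      = ∫⁻ ω, expENN (treeSum treeRule f ⊤ .root 0 ω) ∂prob d μ hmean := by
        simp only [totalPotential_eq_treeSum]
        rfl
    _ ≤ (1 + H 0) * (1 + transition W 0) := h
    _ ≤ (1 + 4⁻¹) * (1 + 4⁻¹) := by
        gcongr
        exacts [hH4 0, (hPW 0).trans (hW4 0)]
    _ ≤ 2 := by
        have h4 : (4⁻¹ : ℝ≥0∞) = ((4⁻¹ : ℝ≥0) : ℝ≥0∞) := by simp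
        rw [h4]
        norm_cast
        rw [← NNReal.coe_le_coe]
        push_cast
        norm_num
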